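/- Let $m>0$ be a non-integer real number, and let $k>0$, $\bar\gamma>0$, $x>0$. Put $k_x=\frac kx$ and $\bar\gamma_x=\frac{k+x}{k+1}\bar\gamma$. For the fluctuating double-Rayleigh with line-of-sight fading channel (shadowing parameter $m$, Rician factor $k$, average signal-to-noise ratio $\bar\gamma$), the probability density function of the instantaneous signal-to-noise ratio conditioned on $x=|G_3|^2$, where $G_3$ is one of the two complex normal factors of the double-Rayleigh component, is $$f_{\gamma_x}(\gamma|x)=\frac{m^m(1+k_x)}{(m+k_x)^m\,\bar\gamma_x}\,e^{-\frac{1+k_x}{\bar\gamma_x}\gamma}\;{}_1F_1\!\left(m;1;\frac{k_x(1+k_x)}{k_x+m}\,\frac{\gamma}{\bar\gamma_x}\right),\qquad \gamma>0,$$ and the conditional ergodic capacity under optimal rate adaptation with constant transmit power (ORA) is $\bar C_x=\int_0^\infty\log_2(1+\gamma)\,f_{\gamma_x}(\gamma|x)\,d\gamma$. This integral converges, and $$\bar C_x=\left(\frac{mx}{k+mx}\right)^{m-1}\frac{1}{\Gamma(1-m)\ln 2}\;G^{0,1:1,2:1,1}_{1,0:2,2:1,2}\!\left(\begin{matrix}0\\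 \text{---}\end{matrix}\,\middle|\,\begin{matrix}1,1\\1,0\end{matrix}\,\middle|\,\begin{matrix}m\\0,0\end{matrix}\,\middle|\,\frac{\bar\gamma(k+mx)}{m(k+1)},\frac{k}{mx}\right).$$ Here the extended generalized bivariate Meijer G-function $G^{m_1,n_1:m_2,n_2:m_3,n_3}_{p_1,q_1:p_2,q_2:p_3,q_3}$ with upper parameters $a^i_1,\dots,a^i_{p_i}$ and lower parameters $b^i_1,\dots,b^i_{q_i}$ $(i=1,2,3)$ is, for $X,Y>0$, $$\frac1{(2\pi j)^2}\int_{\mathcal L_s}\int_{\mathcal L_t}\Psi_1(s+t)\,\Psi_2(s)\,\Psi_3(t)\,X^{-s}Y^{-t}\,ds\,dt,\qquad j^2=-1,$$ $$\Psi_i(\tau)=\frac{\prod_{l=1}^{m_i}\Gamma(b^i_l+\tau)\prod_{l=1}^{n_i}\Gamma(1-a^i_l-\tau)}{\prod_{l=n_i+1}^{p_i}\Gamma(a^i_l+\tau)\prod_{l=m_i+1}^{q_i}\Gamma(1-b^i_l-\tau)},$$ so that in the present case $\Psi_1(\tau)=\Gamma(1-\tau)$, $\Psi_2(\tau)=\frac{\Gamma(1+\tau)\Gamma(-\tau)^2}{\Gamma(1-\tau)}$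 and $\Psi_3(\tau)=\frac{\Gamma(\tau)\Gamma(1-m-\tau)}{\Gamma(1-\tau)}$. The contours $\mathcal L_s,\mathcal L_t$ are piecewise $C^1$ curves running from $-j\infty$ to $+j\infty$, vertical outside a bounded piece and indented where necessary. Each of them has the poles of the factors $\Gamma(b_l+\tau)$, $l\le m_i$, in the numerator of its $\Psi_i$ on its left and the poles of the factors $\Gamma(1-a_l-\tau)$, $l\le n_i$, on its right $(i=2$ for $\mathcal L_s$, $i=3$ for $\mathcal L_t)$, and on $\mathcal L_s\times\mathcal L_t$ the arguments of the gamma functions in the numerator of $\Psi_1(s+t)$ have positive real part. Such contours exist, and for every such pair the double integral converges absolutely and has the same value. -/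

import Mathlib

open MeasureTheory Set

noncomputable section

/-- Kummer's confluent hypergeometric function
`₁F₁(a; b; z) = ∑ₙ (a)ₙ / (b)ₙ * zⁿ / n!` (the series converges for every `z` when `b > 0`). -/
def kummer (a b z : ℝ) : ℝ :=
  ∑' n : ℕ, (ascPochhammer ℝ n).eval a / (ascPochhammer ℝ n).eval b * (z ^ n / (n.factorial : ℝ))

/-- The conditional K-factor `k_x = k / x`. -/
def condK (k x : ℝ) : ℝ := k / x

/-- The conditional average signal-to-noise ratio `(k + x) / (k + 1) * γ̄`. -/
def condAvgSNR (k gbar x : ℝ) : ℝ := (k + x) / (k + 1) * gbar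

/-- The density at `g` of the instantaneous signal-to-noise ratio of the fluctuating
double-Rayleigh with line-of-sight channel, conditioned on `x = |G₃|²`. -/
def condPDF (m k gbar x g : ℝ) : ℝ :=
  m ^ m * (1 + condK k x) / ((m + condK k x) ^ m * condAvgSNR k gbar x)
    * Real.exp (-((1 + condK k x) / condAvgSNR k gbar x * g))
    * kummer m 1
        (condK k x * (1 + condK k x) / (condK k x + m) * (g / condAvgSNR k gbar x))

/-- The integrand of the conditional capacity. -/
def condCapacityIntegrand (m k gbar x g : ℝ) : ℝ :=
  Real.logb 2 (1 + g) * condPDF m k gbar x g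

/-- The conditional ergodic capacity per unit bandwidth under optimal rate adaptation with
constant transmit power. -/
def condCapacityORA (m k gbar x : ℝ) : ℝ :=
  ∫ g in Ioi (0 : ℝ), condCapacityIntegrand m k gbar x g

/-- A Mellin–Barnes contour: a continuous, piecewise `C¹` curve in `ℂ` that runs from
`lo - i∞` to `hi + i∞` and is vertical outside a bounded piece (which may hold
indentations and loops). -/
structure MBContour where
  /-- the parametrization -/
  path : ℝ → ℂ
  continuous_path : Continuous path
  piecewise_C1 : ∃ S : Finset ℝ, ∀ a b : ℝ, a < b → Disjoint (Ioo a b) (S : Set ℝ) →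
    ContDiffOn ℝ 1 path (Icc a b)
  /-- abscissa of the lower end -/
  lo : ℝ
  /-- abscissa of the upper end -/
  hi : ℝ
  vertical_ends : ∃ R : ℝ, 0 < R ∧
    (∀ u : ℝ, u ≤ -R → path u = (lo : ℂ) + (u : ℂ) * Complex.I) ∧
    (∀ u : ℝ, R ≤ u → path u = (hi : ℂ) + (u : ℂ) * Complex.I)

/-- The points off the contour that lie to its left: those that can be joined, without
crossing the contour, to a point whose real part is smaller than that of every point of it. -/
def MBContour.leftSide (L : MBContour) : Set ℂ :=
  {p | ∃ q : ℂ, (∀ u : ℝ, q.re < (L.path u).re) ∧ JoinedIn (range L.path)ᶜ p q}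

/-- The points off the contour that lie to its right. -/
def MBContour.rightSide (L : MBContour) : Set ℂ :=
  {p | ∃ q : ℂ, (∀ u : ℝ, (L.path u).re < q.re) ∧ JoinedIn (range L.path)ᶜ p q}

/-- One group of parameters of a Meijer-type function: the orders `m ≤ q`, `n ≤ p`, the upper
list `a₁, …, a_p` and the lower list `b₁, …, b_q`. -/
structure MeijerParams where
  m : ℕ
  n : ℕ
  a : List ℂ
  b : List ℂ
  hm : m ≤ b.length
  hn : n ≤ a.length

/-- The quotient of gamma functions
`∏_{j ≤ m} Γ(b_j + τ) ∏_{j ≤ n} Γ(1 - a_j - τ) /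
  (∏_{n < j ≤ p} Γ(a_j + τ) ∏_{m < j ≤ q} Γ(1 - b_j - τ))`. -/
def MeijerParams.Psi (P : MeijerParams) (τ : ℂ) : ℂ :=
  (((P.b.take P.m).map fun b => Complex.Gamma (b + τ)).prod
      * ((P.a.take P.n).map fun a => Complex.Gamma (1 - a - τ)).prod)
    / (((P.a.drop P.n).map fun a => Complex.Gamma (a + τ)).prod
      * ((P.b.drop P.m).map fun b => Complex.Gamma (1 - b - τ)).prod)

/-- The contour separates the poles `-b_j - i` of the factors `Γ(b_j + τ)` (on its left) from the
poles `1 - a_j + i` of the factors `Γ(1 - a_j - τ)` (on its right), `i = 0, 1, 2, …`. -/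
def MeijerParams.SeparatedBy (P : MeijerParams) (L : MBContour) : Prop :=
  (∀ b ∈ P.b.take P.m, ∀ i : ℕ, -b - (i : ℂ) ∈ L.leftSide) ∧
  (∀ a ∈ P.a.take P.n, ∀ i : ℕ, 1 - a + (i : ℂ) ∈ L.rightSide)

/-- Admissible pairs of contours for the bivariate Meijer G-function: each contour separates the
two families of poles in its own variable, and on the product of the contours the arguments of
the gamma functions in the numerator of `Ψ₁(s + t)` have positive real part, so that the poles
of these coupled factors stay on their own sides, too. -/
structure EGBMGAdmissible (P₁ P₂ P₃ : MeijerParams) (Ls Lt : MBContour) : Prop where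
  sep_s : P₂.SeparatedBy Ls
  sep_t : P₃.SeparatedBy Lt
  coupled_b : ∀ b ∈ P₁.b.take P₁.m, ∀ u v : ℝ, 0 < (b + (Ls.path u + Lt.path v)).re
  coupled_a : ∀ a ∈ P₁.a.take P₁.n, ∀ u v : ℝ, 0 < (1 - a - (Ls.path u + Lt.path v)).re

/-- The double Mellin–Barnes integrand `Ψ₁(s + t) Ψ₂(s) Ψ₃(t) x⁻ˢ y⁻ᵗ ds dt`, pulled back to the
parameters of the contours. -/
def egbmgIntegrand (P₁ P₂ P₃ : MeijerParams) (x y : ℝ) (Ls Lt : MBContour) (u v : ℝ) : ℂ :=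
  P₁.Psi (Ls.path u + Lt.path v) * P₂.Psi (Ls.path u) * P₃.Psi (Lt.path v)
    * (x : ℂ) ^ (-(Ls.path u)) * (y : ℂ) ^ (-(Lt.path v))
    * deriv Ls.path u * deriv Lt.path v

/-- `w` is the value at `(x, y)` of the extended generalized bivariate Meijer G-function with the
parameter groups `P₁` (for `s + t`), `P₂` (for `s`), `P₃` (for `t`): admissible contours exist, and
for every admissible pair the double Mellin–Barnes integral converges absolutely and equals `w`.
At most one `w` has this property. -/
def HasEGBMG (P₁ P₂ P₃ : MeijerParams) (x y : ℝ) (w : ℂ) : Prop :=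
  (∃ Ls Lt : MBContour, EGBMGAdmissible P₁ P₂ P₃ Ls Lt) ∧
  ∀ Ls Lt : MBContour, EGBMGAdmissible P₁ P₂ P₃ Ls Lt →
    Integrable (fun z : ℝ × ℝ => egbmgIntegrand P₁ P₂ P₃ x y Ls Lt z.1 z.2)
      (volume.prod volume) ∧
    1 / (2 * (Real.pi : ℂ) * Complex.I) ^ 2
      * (∫ u : ℝ, ∫ v : ℝ, egbmgIntegrand P₁ P₂ P₃ x y Ls Lt u v) = w

end

/-! The double integral splits into two classical Mellin–Barnes integrals. On the `s`-contour,
reflection gives `Ψ₂(s) = π / (s sin πs)`, and `∫ Ψ₂(s) y⁻ˢ ds = 2πi log(1 + y)`. On the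
`t`-contour, `∫ Ψ₃(t) y⁻ᵗ dt = 2πi Γ(1 - m) e⁻ʸ ₁F₁(m; 1; y)`. The coupling factor is Euler's
integral `Γ(1 - s - t) = ∫₀^∞ e⁻ʳ r^(-s-t) dr`, valid because `Re(s + t) < 1`. By Fubini
(`integral_Gamma_coupled`) the double integral equals `(2πi)² Γ(1 - m) ∫₀^∞ e⁻ʳ log(1 + Xr) e^(-Yr)
₁F₁(m; 1; Yr) dr`, and the substitution `γ = Xr` turns the capacity into a multiple of this
integral. Fubini also yields both convergence claims.

The contours are arbitrary and "left" and "right" are topological notions, so a residue theorem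
adapted to them is needed. The principal value of `∫ ds/(s - p)` is `πi` for `p` on the left and
`-πi` for `p` on the right (a winding-number argument). Subtracting principal parts leaves a
holomorphic function on a strip, which has a primitive because the strip is convex. Hence moving a
contour to a vertical line far to the left costs `2πi` times the residues on its left
(`integral_sub_verticalLine`).

For the logarithm the residues form the power series of `log(1 + y)` when `y < 1`; larger `y` follow
from the symmetry `s ↦ -s` of the kernel. For the Kummer kernel the functional equation of `Γ` makes
the far line negligible for every `y`; the residue series is `Γ(1 - m) ₁F₁(1 - m; 1; -y)`, and
Kummer's transformation finishes. The decay needed comes from bounds for `Γ` on vertical strips.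

An admissible pair exists although, for `m > 1`, the two families of poles of `Ψ₃` interlace on the
real axis: a contour following a trigonometric wave passes below one family and above the other
(`separatesKummer_separating`). -/

noncomputable section

open Filter Topology

/-! ### Regularity of contours and integration along bounded pieces -/

namespace MBContour

variable (L : MBContour)

/-- The derivative may jump at `x`, but the other break points keep a positive distance. One-sided
regularity suffices for local integrability of the derivative. -/
lemma exists_pieces (x : ℝ) : ∃ δ > 0, ContDiffOn ℝ 1 L.path (Icc (x - δ) x) ∧
    ContDiffOn ℝ 1 L.path (Icc x (x + δ)) := by
  obtain ⟨S, hS⟩ := L.piecewise_C1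
  have hcl : IsClosed ((S : Set ℝ) \ {x}) := ((S.finite_toSet).subset sdiff_subset).isClosed
  obtain ⟨δ, hδ, hball⟩ := Metric.isOpen_iff.1 hcl.isOpen_compl x (by simp)
  have key : ∀ y, |y - x| < δ → y ≠ x → y ∉ (S : Set ℝ) := by
    intro y hy hne hyS
    exact hball (by simpa [Real.dist_eq] using hy) ⟨hyS, hne⟩
  refine ⟨δ, hδ, hS _ _ (by linarith) ?_, hS _ _ (by linarith) ?_⟩
  · refine Set.disjoint_left.2 fun y hy => key y ?_ hy.2.ne
    rw [abs_lt]; constructor <;> linarith [hy.1, hy.2]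
  · refine Set.disjoint_left.2 fun y hy => key y ?_ hy.1.ne'
    rw [abs_lt]; constructor <;> linarith [hy.1, hy.2]

lemma exists_countable_contDiffAt :
    ∃ S : Set ℝ, S.Countable ∧ ∀ u ∉ S, ContDiffAt ℝ 1 L.path u := by
  obtain ⟨S, hS⟩ := L.piecewise_C1
  refine ⟨S, S.countable_toSet, fun x hx => ?_⟩
  obtain ⟨δ, hδ, hball⟩ := Metric.isOpen_iff.1 S.finite_toSet.isClosed.isOpen_compl x hx
  have h := hS (x - δ) (x + δ) (by linarith) (Set.disjoint_left.2 fun y hy => by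
    apply hball
    rw [Metric.mem_ball, Real.dist_eq, abs_lt]; constructor <;> linarith [hy.1, hy.2])
  exact h.contDiffAt (Icc_mem_nhds (by linarith) (by linarith))

lemma _root_.integrableOn_deriv_of_contDiffOn_Icc {f : ℝ → ℂ} {a b : ℝ} (hab : a < b)
    (h : ContDiffOn ℝ 1 f (Icc a b)) : IntegrableOn (deriv f) (Icc a b) := by
  have h1 : ContinuousOn (derivWithin f (Icc a b)) (Icc a b) :=
    h.continuousOn_derivWithin (uniqueDiffOn_Icc hab) le_rfl
  have h2 := (h1.integrableOn_compact (μ := volume) isCompact_Icc).mono_set Ioo_subset_Icc_self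
  rw [integrableOn_Icc_iff_integrableOn_Ioo]
  refine h2.congr_fun (fun x hx => ?_) measurableSet_Ioo
  exact derivWithin_of_mem_nhds (Icc_mem_nhds hx.1 hx.2)

lemma locallyIntegrable_deriv : LocallyIntegrable (deriv L.path) := by
  intro x
  obtain ⟨δ, hδ, h1, h2⟩ := L.exists_pieces x
  refine ⟨Icc (x - δ) (x + δ), Icc_mem_nhds (by linarith) (by linarith), ?_⟩
  rw [← Icc_union_Icc_eq_Icc (show x - δ ≤ x by linarith) (show x ≤ x + δ by linarith)]
  exact (integrableOn_deriv_of_contDiffOn_Icc (by linarith) h1).union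
    (integrableOn_deriv_of_contDiffOn_Icc (by linarith) h2)

lemma intervalIntegrable_mul_deriv {f : ℝ → ℂ} (hf : Continuous f) (a b : ℝ) :
    IntervalIntegrable (fun u => f u * deriv L.path u) volume a b := by
  have h : IntervalIntegrable (deriv L.path) volume a b :=
    (L.locallyIntegrable_deriv.integrableOn_isCompact isCompact_uIcc).intervalIntegrable
  exact h.continuousOn_mul hf.continuousOn

/-- The integral of `f` over the part of the contour with parameters in `[a, b]`. -/
def integralOn (f : ℂ → ℂ) (a b : ℝ) : ℂ := ∫ u in a..b, f (L.path u) * deriv L.path u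

/-- The fundamental theorem of calculus tolerates a countable exceptional set on which the function
is merely continuous; the corners form such a set. -/
lemma integralOn_eq_sub {f Φ : ℂ → ℂ} (hf : Continuous fun u => f (L.path u))
    (h : ∀ u, HasDerivAt Φ (f (L.path u)) (L.path u)) (a b : ℝ) :
    L.integralOn f a b = Φ (L.path b) - Φ (L.path a) := by
  obtain ⟨S, hS, hd⟩ := L.exists_countable_contDiffAt
  refine integral_eq_of_hasDerivAt_off_countable (fun u => Φ (L.path u)) _ hS ?_ ?_
    (L.intervalIntegrable_mul_deriv hf a b)
  · exact (continuous_iff_continuousAt.2 fun u =>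
      (h u).continuousAt.comp L.continuous_path.continuousAt).continuousOn
  · intro u hu
    have hd' := ((hd u hu.2).differentiableAt one_ne_zero).hasDerivAt
    simpa [mul_comm, Function.comp_def] using (h u).scomp u hd'

/-- The last inequality is strict because the path may have a corner at `u = ±R`. -/
lemma exists_deriv_eq_I : ∃ R : ℝ, 0 < R ∧
    (∀ u : ℝ, u ≤ -R → L.path u = (L.lo : ℂ) + (u : ℂ) * Complex.I) ∧
    (∀ u : ℝ, R ≤ u → L.path u = (L.hi : ℂ) + (u : ℂ) * Complex.I) ∧
    ∀ u : ℝ, R < |u| → deriv L.path u = Complex.I := by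
  obtain ⟨R, hR, h1, h2⟩ := L.vertical_ends
  refine ⟨R, hR, h1, h2, fun u hu => ?_⟩
  have key : ∀ c : ℝ, HasDerivAt (fun u : ℝ => (c : ℂ) + (u : ℂ) * Complex.I) Complex.I u := by
    intro c
    simpa using ((hasDerivAt_id (u : ℂ)).comp_ofReal.mul_const Complex.I).const_add (c : ℂ)
  rcases lt_abs.1 hu with h | h
  · refine ((key L.hi).congr_of_eventuallyEq ?_).deriv
    filter_upwards [lt_mem_nhds h] with v hv using h2 v hv.le
  · refine ((key L.lo).congr_of_eventuallyEq ?_).deriv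
    filter_upwards [gt_mem_nhds (show u < -R by linarith)] with v hv using h1 v hv.le

/-- That the bounds are attained later turns the pointwise condition `Re(s + t) < 1` into a bound by
a constant below `1`. -/
lemma exists_re_bounds : ∃ a b : ℝ, (∃ u, (L.path u).re = a) ∧ (∃ u, (L.path u).re = b) ∧
    ∀ u, a ≤ (L.path u).re ∧ (L.path u).re ≤ b := by
  obtain ⟨R, hR, h1, h2⟩ := L.vertical_ends
  have hc : ContinuousOn (fun u => (L.path u).re) (Icc (-R) R) :=
    (Complex.continuous_re.comp L.continuous_path).continuousOn
  obtain ⟨u₀, hu₀, hmin⟩ := isCompact_Icc.exists_isMinOn ⟨0, by constructor <;> linarith⟩ hc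
  obtain ⟨u₁, hu₁, hmax⟩ := isCompact_Icc.exists_isMaxOn ⟨0, by constructor <;> linarith⟩ hc
  refine ⟨_, _, ⟨u₀, rfl⟩, ⟨u₁, rfl⟩, fun u => ?_⟩
  have key : ∃ v ∈ Icc (-R) R, (L.path u).re = (L.path v).re := by
    rcases le_total u (-R) with h | h
    · exact ⟨-R, by constructor <;> linarith, by rw [h1 u h, h1 (-R) le_rfl]; simp⟩
    rcases le_total R u with h' | h'
    · exact ⟨R, by constructor <;> linarith, by rw [h2 u h', h2 R le_rfl]; simp⟩
    · exact ⟨u, ⟨h, h'⟩, rfl⟩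
  obtain ⟨v, hv, e⟩ := key
  rw [e]
  exact ⟨hmin hv, hmax hv⟩

end MBContour

/-! ### Principal values of `∫ ds / (s - p)` and the sides of a contour -/

namespace MBContour

variable (L : MBContour)

/-- With `W` the primitive of the integrand, `(path u - z) exp(-W u)` is continuous and has zero
derivative off a countable set, so it is constant. -/
lemma exp_integralOn_inv {z : ℂ} (hz : z ∉ range L.path) (a b : ℝ) :
    Complex.exp (L.integralOn (fun s => (s - z)⁻¹) a b) = (L.path b - z) / (L.path a - z) := by
  obtain ⟨S, hS, hd⟩ := L.exists_countable_contDiffAt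
  have hne : ∀ u, L.path u - z ≠ 0 := fun u h => hz ⟨u, sub_eq_zero.1 h⟩
  have hc : Continuous fun u => (L.path u - z)⁻¹ :=
    (L.continuous_path.sub continuous_const).inv₀ hne
  set g : ℝ → ℂ := fun u => (L.path u - z)⁻¹ * deriv L.path u with hg
  have hgi : ∀ a b, IntervalIntegrable g volume a b := fun a b =>
    L.intervalIntegrable_mul_deriv hc a b
  set W : ℝ → ℂ := fun u => ∫ v in a..u, g v with hW
  have hWc : Continuous W := intervalIntegral.continuous_primitive hgi a
  have key := integral_eq_of_hasDerivAt_off_countable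
    (fun u => (L.path u - z) * Complex.exp (-W u)) (fun _ => 0) (a := a) (b := b) hS
    (by
      have := L.continuous_path
      fun_prop) (fun u hu => by
      have h1 := hd u hu.2
      have hcd : ContinuousAt (deriv L.path) u := by
        have := (h1.fderiv_right (m := 0) le_rfl).continuousAt
        exact this.clm_apply (continuousAt_const (y := (1 : ℝ)))
      have h2 : HasDerivAt W (g u) u :=
        intervalIntegral.integral_hasDerivAt_right (hgi a u)
          (((hc.measurable.mul (measurable_deriv _)).stronglyMeasurable).stronglyMeasurableAtFilter)
          (hc.continuousAt.mul hcd)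
      have h3 := (h1.differentiableAt one_ne_zero).hasDerivAt.sub_const z
      refine (h3.mul h2.neg.cexp).congr_deriv ?_
      simp only [hg, Pi.neg_apply]
      field_simp [hne u]
      ring) (by simp)
  simp only [intervalIntegral.integral_zero] at key
  have hWa : W a = 0 := by simp [hW]
  rw [hWa] at key
  simp only [neg_zero, Complex.exp_zero, mul_one] at key
  change Complex.exp (W b) = _
  rw [eq_div_iff (hne a), ← sub_eq_zero.1 key.symm, mul_left_comm, ← Complex.exp_add]
  simp

lemma continuous_integralOn_inv_comp {γ : C(unitInterval, ℂ)} (hγ : ∀ τ, γ τ ∉ range L.path)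
    (a b : ℝ) : Continuous fun τ => L.integralOn (fun s => (s - γ τ)⁻¹) a b := by
  have hne : ∀ τ u, L.path u - γ τ ≠ 0 := fun τ u h => hγ τ ⟨u, sub_eq_zero.1 h⟩
  have hc : Continuous fun x : unitInterval × ℝ => (L.path x.2 - γ x.1)⁻¹ := by
    refine Continuous.inv₀ ?_ fun x => hne _ _
    have := L.continuous_path
    fun_prop
  obtain ⟨M, hM⟩ := (isCompact_univ.prod
    (isCompact_uIcc (a := a) (b := b))).exists_bound_of_continuousOn hc.continuousOn
  unfold integralOn
  refine intervalIntegral.continuous_of_dominated_interval (bound := fun u => M * ‖deriv L.path u‖)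
    (fun τ => ?_) (fun τ => ?_) ?_ ?_
  · exact ((hc.comp (by fun_prop : Continuous fun u : ℝ => (τ, u))).measurable.mul
      (measurable_deriv _)).aestronglyMeasurable
  · refine Eventually.of_forall fun u hu => ?_
    rw [norm_mul]
    gcongr
    exact hM (τ, u) ⟨mem_univ _, uIoc_subset_uIcc hu⟩
  · have h : IntervalIntegrable (deriv L.path) volume a b :=
      (L.locallyIntegrable_deriv.integrableOn_isCompact isCompact_uIcc).intervalIntegrable
    exact h.norm.const_mul M
  · refine Eventually.of_forall fun u _ => ?_
    exact (hc.comp (by fun_prop : Continuous fun τ : unitInterval => (τ, u))).mul continuous_const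

/-- `V / (2πi)` is continuous and integer-valued on a connected space. -/
lemma _root_.eq_of_continuous_of_exp_eq_one {V : unitInterval → ℂ} (hV : Continuous V)
    (h : ∀ τ, Complex.exp (V τ) = 1) (τ τ' : unitInterval) : V τ = V τ' := by
  choose n hn using fun τ => Complex.exp_eq_one_iff.1 (h τ)
  have hcast : Continuous fun τ => ((n τ : ℤ) : ℝ) := by
    have : (fun τ => ((n τ : ℤ) : ℝ)) = fun τ => (V τ / (2 * Real.pi * Complex.I)).re := by
      funext τ
      rw [hn τ, mul_div_assoc, div_self Complex.two_pi_I_ne_zero]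
      simp
    rw [this]
    fun_prop
  have hnc : Continuous n := Int.isClosedEmbedding_coe_real.isInducing.continuous_iff.2 hcast
  rw [hn τ, hn τ', PreconnectedSpace.constant inferInstance hnc]

/-- Along a curve that avoids the contour, `∫ ds / (s - z)` over a long stretch of the contour
changes like the difference of the principal logarithms at the ends. -/
lemma integralOn_inv_sub_log_const {p q : ℂ} (h : JoinedIn (range L.path)ᶜ p q) :
    ∀ᶠ T in atTop,
      L.integralOn (fun s => (s - p)⁻¹) (-T) T
          - (Complex.log (L.path T - p) - Complex.log (L.path (-T) - p)) =
      L.integralOn (fun s => (s - q)⁻¹) (-T) T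
          - (Complex.log (L.path T - q) - Complex.log (L.path (-T) - q)) := by
  obtain ⟨R, hR, h1, h2⟩ := L.vertical_ends
  obtain ⟨M, hM⟩ := isCompact_univ.exists_bound_of_continuousOn h.somePath.continuous.continuousOn
  -- For such `T` the end points lie above and below the whole joining curve, so their differences
  -- from it never meet the branch cut and the logarithms vary continuously.
  filter_upwards [eventually_ge_atTop R, eventually_gt_atTop M] with T hTR hTM
  have hγ : ∀ τ, h.somePath τ ∉ range L.path := fun τ => h.somePath_mem τ
  have him : ∀ τ, |(h.somePath τ).im| < T := fun τ =>
    (Complex.abs_im_le_norm _).trans_lt ((hM τ (mem_univ _)).trans_lt hTM)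
  have hs1 : ∀ τ, L.path T - h.somePath τ ∈ Complex.slitPlane := fun τ => by
    refine Complex.mem_slitPlane_iff.2 (Or.inr (ne_of_gt ?_))
    rw [h2 T hTR]
    simpa using (abs_lt.1 (him τ)).2
  have hs2 : ∀ τ, L.path (-T) - h.somePath τ ∈ Complex.slitPlane := fun τ => by
    refine Complex.mem_slitPlane_iff.2 (Or.inr (ne_of_lt ?_))
    rw [h1 (-T) (by linarith)]
    simpa using (abs_lt.1 (him τ)).1
  have hcont : Continuous h.somePath := h.somePath.continuous
  have := eq_of_continuous_of_exp_eq_one (V := fun τ =>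
    L.integralOn (fun s => (s - h.somePath τ)⁻¹) (-T) T
      - (Complex.log (L.path T - h.somePath τ) - Complex.log (L.path (-T) - h.somePath τ)))
    ((L.continuous_integralOn_inv_comp (γ := h.somePath.toContinuousMap) hγ _ _).sub
      (((continuous_const.sub hcont).clog hs1).sub ((continuous_const.sub hcont).clog hs2)))
    (fun τ => by
      rw [Complex.exp_sub, Complex.exp_sub, L.exp_integralOn_inv (hγ τ),
        Complex.exp_log (Complex.slitPlane_ne_zero (hs1 τ)),
        Complex.exp_log (Complex.slitPlane_ne_zero (hs2 τ)), div_self]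
      exact div_ne_zero (Complex.slitPlane_ne_zero (hs1 τ)) (Complex.slitPlane_ne_zero (hs2 τ)))
    0 1
  simpa using this

/-- Factoring out `T` gives `T(i + o(1))` at the upper end and `T(-i + o(1))` at the lower one; `log
T` cancels and `log i - log(-i) = πi` remains. -/
lemma tendsto_log_sub_log (p : ℂ) :
    Tendsto (fun T => Complex.log (L.path T - p) - Complex.log (L.path (-T) - p)) atTop
      (𝓝 (Real.pi * Complex.I)) := by
  obtain ⟨R, hR, h1, h2⟩ := L.vertical_ends
  have hinv : ∀ c : ℂ, Tendsto (fun T : ℝ => c * ((T⁻¹ : ℝ) : ℂ)) atTop (𝓝 0) := fun c => by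
    have := (Complex.continuous_ofReal.tendsto 0).comp tendsto_inv_atTop_zero
    simpa using this.const_mul c
  have hI : Tendsto (fun T : ℝ => Complex.log (Complex.I + (L.hi - p) * ((T⁻¹ : ℝ) : ℂ))
      - Complex.log (-Complex.I + (L.lo - p) * ((T⁻¹ : ℝ) : ℂ))) atTop
      (𝓝 (Complex.log Complex.I - Complex.log (-Complex.I))) := by
    refine Tendsto.sub (Tendsto.clog ?_ ?_) (Tendsto.clog ?_ ?_)
    · simpa using (hinv (L.hi - p)).const_add Complex.I
    · simp [Complex.mem_slitPlane_iff]
    · simpa using (hinv (L.lo - p)).const_add (-Complex.I)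
    · simp [Complex.mem_slitPlane_iff]
  have e : Complex.log Complex.I - Complex.log (-Complex.I) = Real.pi * Complex.I := by
    rw [Complex.log_I, Complex.log_neg_I]; ring
  rw [e] at hI
  refine hI.congr' ?_
  have hne1 : ∀ᶠ T : ℝ in atTop, Complex.I + (L.hi - p) * ((T⁻¹ : ℝ) : ℂ) ≠ 0 := by
    have h := (hinv (L.hi - p)).const_add Complex.I
    rw [add_zero] at h
    exact h.eventually_ne Complex.I_ne_zero
  have hne2 : ∀ᶠ T : ℝ in atTop, -Complex.I + (L.lo - p) * ((T⁻¹ : ℝ) : ℂ) ≠ 0 := by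
    have h := (hinv (L.lo - p)).const_add (-Complex.I)
    rw [add_zero] at h
    exact h.eventually_ne (neg_ne_zero.2 Complex.I_ne_zero)
  filter_upwards [eventually_ge_atTop R, hne1, hne2] with T hT hn1 hn2
  have hT0 : 0 < T := hR.trans_le hT
  have hTc : (T : ℂ) ≠ 0 := by exact_mod_cast hT0.ne'
  have e1 : L.path T - p = (T : ℂ) * (Complex.I + (L.hi - p) * ((T⁻¹ : ℝ) : ℂ)) := by
    rw [h2 T hT]; push_cast; field_simp; ring
  have e2 : L.path (-T) - p = (T : ℂ) * (-Complex.I + (L.lo - p) * ((T⁻¹ : ℝ) : ℂ)) := by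
    rw [h1 (-T) (by linarith)]; push_cast; field_simp; ring
  rw [e1, e2, Complex.log_ofReal_mul hT0 hn1, Complex.log_ofReal_mul hT0 hn2]
  ring

/-- By constancy along the joining curve it suffices to treat `q`. There `Re(s - q) > 0` on the
contour, so the principal `log(s - q)` is a primitive and the correction vanishes. -/
lemma tendsto_integralOn_inv_of_mem_leftSide {p : ℂ} (hp : p ∈ L.leftSide) :
    Tendsto (fun T => L.integralOn (fun s => (s - p)⁻¹) (-T) T) atTop
      (𝓝 (Real.pi * Complex.I)) := by
  obtain ⟨q, hq, hj⟩ := hp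
  refine (L.tendsto_log_sub_log p).congr' ?_
  filter_upwards [L.integralOn_inv_sub_log_const hj] with T hT
  have hs : ∀ u, L.path u - q ∈ Complex.slitPlane := fun u =>
    Complex.mem_slitPlane_iff.2 (Or.inl (by simpa using hq u))
  have := L.integralOn_eq_sub (f := fun s => (s - q)⁻¹) (Φ := fun s => Complex.log (s - q))
    ((L.continuous_path.sub continuous_const).inv₀ fun u => Complex.slitPlane_ne_zero (hs u))
    (fun u => by simpa using ((hasDerivAt_id (L.path u)).sub_const q).clog (hs u)) (-T) T
  rw [this, sub_self] at hT
  exact (sub_eq_zero.1 hT).symm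

/-- Now `log(q - s)` is the primitive at `q`. It differs from `log(s - q)` by `-πi` at the upper end
and `+πi` at the lower end, which shifts the limit `πi` by `-2πi`. -/
lemma tendsto_integralOn_inv_of_mem_rightSide {p : ℂ} (hp : p ∈ L.rightSide) :
    Tendsto (fun T => L.integralOn (fun s => (s - p)⁻¹) (-T) T) atTop
      (𝓝 (-(Real.pi * Complex.I))) := by
  obtain ⟨q, hq, hj⟩ := hp
  have hlim := (L.tendsto_log_sub_log p).sub_const (2 * (Real.pi * Complex.I))
  rw [show (Real.pi * Complex.I : ℂ) - 2 * (Real.pi * Complex.I) = -(Real.pi * Complex.I) by ring]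
    at hlim
  refine hlim.congr' ?_
  obtain ⟨R, hR, h1, h2⟩ := L.vertical_ends
  filter_upwards [L.integralOn_inv_sub_log_const hj, eventually_ge_atTop R,
    eventually_gt_atTop |q.im|] with T hT hTR hTq
  have hs : ∀ u, q - L.path u ∈ Complex.slitPlane := fun u =>
    Complex.mem_slitPlane_iff.2 (Or.inl (by simpa using hq u))
  have hne : ∀ u, L.path u - q ≠ 0 := fun u h => by
    apply Complex.slitPlane_ne_zero (hs u); rw [← neg_sub, h, neg_zero]
  have := L.integralOn_eq_sub (f := fun s => (s - q)⁻¹) (Φ := fun s => Complex.log (q - s))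
    ((L.continuous_path.sub continuous_const).inv₀ hne)
    (fun u => by
      refine (((hasDerivAt_id (L.path u)).const_sub q).clog (hs u)).congr_deriv ?_
      rw [id, ← neg_sub (L.path u) q, neg_div_neg_eq, one_div]) (-T) T
  have l1 : Complex.log (q - L.path T) = Complex.log (L.path T - q) - Real.pi * Complex.I := by
    rw [← neg_sub, Complex.log, Complex.log, norm_neg,
      Complex.arg_neg_eq_arg_sub_pi_of_im_pos]
    · push_cast; ring
    · rw [h2 T hTR]; simpa using (abs_lt.1 hTq).2
  have l2 : Complex.log (q - L.path (-T)) =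
      Complex.log (L.path (-T) - q) + Real.pi * Complex.I := by
    rw [← neg_sub, Complex.log, Complex.log, norm_neg,
      Complex.arg_neg_eq_arg_add_pi_of_im_neg]
    · push_cast; ring
    · rw [h1 (-T) (by linarith)]; simpa using (abs_lt.1 hTq).1
  rw [this, l1, l2] at hT
  linear_combination -hT

end MBContour

/-! ### Residue theorem for two contours in a vertical strip -/

/-- The open vertical strip `a < Re s < b`. -/
def reStrip (a b : ℝ) : Set ℂ := {s | a < s.re ∧ s.re < b}

lemma isOpen_reStrip (a b : ℝ) : IsOpen (reStrip a b) :=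
  (isOpen_lt continuous_const Complex.continuous_re).inter
    (isOpen_lt Complex.continuous_re continuous_const)

lemma convex_reStrip (a b : ℝ) : Convex ℝ (reStrip a b) :=
  (convex_halfSpace_re_gt a).inter (convex_halfSpace_re_lt b)

/-- The filter of points of the strip with `|Im s| → ∞`. -/
def stripAtInfty (a b : ℝ) : Filter ℂ :=
  comap (fun s : ℂ => |s.im|) atTop ⊓ 𝓟 (reStrip a b)

lemma eventually_stripAtInfty {a b : ℝ} {p : ℂ → Prop} :
    (∀ᶠ s in stripAtInfty a b, p s) ↔ ∃ T : ℝ, ∀ s ∈ reStrip a b, T ≤ |s.im| → p s := by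
  have h : (comap (fun s : ℂ => |s.im|) atTop).HasBasis (fun _ : ℝ => True)
      fun T => {s | T ≤ |s.im|} := atTop_basis.comap _
  rw [stripAtInfty, eventually_inf_principal, h.eventually_iff]
  simp only [true_and, mem_ofPred_eq]
  exact exists_congr fun T => forall_congr' fun s => by tauto

lemma tendsto_sub_inv_stripAtInfty (a b : ℝ) (p : ℂ) :
    Tendsto (fun s => (s - p)⁻¹) (stripAtInfty a b) (𝓝 0) := by
  have h : Tendsto (fun s : ℂ => |s.im|) (stripAtInfty a b) atTop :=
    tendsto_comap.mono_left inf_le_left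
  refine tendsto_inv₀_cobounded.comp (tendsto_norm_atTop_iff_cobounded.1 ?_)
  refine tendsto_atTop_mono (fun s => ?_) (tendsto_atTop_add_const_right _ (-|p.im|) h)
  calc |s.im| + -|p.im| ≤ |s.im - p.im| := by linarith [abs_sub_abs_le_abs_sub s.im p.im]
    _ = |(s - p).im| := by simp
    _ ≤ ‖s - p‖ := Complex.abs_im_le_norm _

/-- `F` has at `p` an isolated singularity with principal part `c₂ / (s - p)² + c₁ / (s - p)`. -/
def HasPrincipalPart (F : ℂ → ℂ) (p c₂ c₁ : ℂ) : Prop :=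
  ∃ e : ℂ → ℂ, AnalyticAt ℂ e p ∧ ∀ᶠ s in 𝓝[≠] p, F s = c₂ / (s - p) ^ 2 + c₁ / (s - p) + e s

lemma analyticAt_dslope {h : ℂ → ℂ} {p : ℂ} (hh : AnalyticAt ℂ h p) :
    AnalyticAt ℂ (dslope h p) p := by
  obtain ⟨q, hq⟩ := hh
  exact ⟨_, hq.has_fpower_series_dslope_fslope⟩

lemma hasPrincipalPart_of_eq_div {F h : ℂ → ℂ} {p : ℂ} (hh : AnalyticAt ℂ h p)
    (hF : ∀ᶠ s in 𝓝[≠] p, F s = h s / (s - p)) : HasPrincipalPart F p 0 (h p) := by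
  refine ⟨dslope h p, analyticAt_dslope hh, ?_⟩
  filter_upwards [hF, self_mem_nhdsWithin] with s hs hne
  have : s - p ≠ 0 := sub_ne_zero.2 hne
  rw [hs, dslope_of_ne _ hne, slope_def_field]
  field_simp
  ring

/-- Second-order Taylor expansion of `h`; the iterated `dslope` is the analytic remainder. -/
lemma hasPrincipalPart_of_eq_div_sq {F h : ℂ → ℂ} {p : ℂ} (hh : AnalyticAt ℂ h p)
    (hF : ∀ᶠ s in 𝓝[≠] p, F s = h s / (s - p) ^ 2) :
    HasPrincipalPart F p (h p) (deriv h p) := by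
  refine ⟨dslope (dslope h p) p, analyticAt_dslope (analyticAt_dslope hh), ?_⟩
  filter_upwards [hF, self_mem_nhdsWithin] with s hs hne
  have : s - p ≠ 0 := sub_ne_zero.2 hne
  rw [hs, dslope_of_ne _ hne, slope_def_field, dslope_same, dslope_of_ne _ hne, slope_def_field]
  field_simp
  ring

namespace MBContour

lemma not_mem_range_of_mem_leftSide {L : MBContour} {p : ℂ} (h : p ∈ L.leftSide) :
    p ∉ range L.path := by
  obtain ⟨q, -, hj⟩ := h
  exact hj.source_mem

lemma not_mem_range_of_mem_rightSide {L : MBContour} {p : ℂ} (h : p ∈ L.rightSide) :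
    p ∉ range L.path := by
  obtain ⟨q, -, hj⟩ := h
  exact hj.source_mem

/-- At equal height the two points are joined by a horizontal segment shorter than the width of the
strip, along which `Φ' = F` is uniformly small; the mean value inequality applies. -/
lemma _root_.tendsto_sub_of_hasDerivAt_reStrip {a b : ℝ} {F Φ : ℂ → ℂ}
    (hΦ : ∀ s ∈ reStrip a b, HasDerivAt Φ (F s) s) (hF : Tendsto F (stripAtInfty a b) (𝓝 0))
    {z w : ℝ → ℂ} (hz : ∀ T, z T ∈ reStrip a b) (hw : ∀ T, w T ∈ reStrip a b)
    (him : ∀ᶠ T in atTop, (z T).im = (w T).im)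
    (hlim : Tendsto (fun T => |(z T).im|) atTop atTop) :
    Tendsto (fun T => Φ (z T) - Φ (w T)) atTop (𝓝 0) := by
  rw [Metric.tendsto_nhds]
  intro ε hε
  have hab : 0 < b - a := by linarith [(hz 0).1, (hz 0).2]
  obtain ⟨M, hM⟩ := eventually_stripAtInfty.1
    (hF.norm.eventually_lt_const (show ‖(0 : ℂ)‖ < ε / (b - a) by rw [norm_zero]; positivity))
  filter_upwards [him, hlim.eventually_ge_atTop M] with T hT hTM
  have hconv : Convex ℝ (reStrip a b ∩ {s | s.im = (z T).im}) :=
    (convex_reStrip a b).inter (convex_hyperplane ⟨Complex.add_im, fun c x => by simp⟩ _)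
  have hle := hconv.norm_image_sub_le_of_norm_hasDerivWithin_le (f := Φ) (C := ε / (b - a))
    (fun s hs => (hΦ s hs.1).hasDerivWithinAt)
    (fun s hs => (hM s hs.1 (by rw [hs.2]; exact hTM)).le) ⟨hw T, hT.symm⟩ ⟨hz T, rfl⟩
  have hd : ‖z T - w T‖ < b - a := by
    have : z T - w T = (((z T).re - (w T).re : ℝ) : ℂ) := by
      apply Complex.ext <;> simp [hT]
    rw [this, Complex.norm_real, Real.norm_eq_abs, abs_lt]
    constructor <;> linarith [(hz T).1, (hz T).2, (hw T).1, (hw T).2]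
  rw [dist_zero_right]
  calc _ ≤ _ := hle
    _ < ε / (b - a) * (b - a) := by gcongr
    _ = ε := by field_simp

variable {L₁ L₂ : MBContour} {a b : ℝ}

lemma eventually_im_path (L : MBContour) :
    (∀ᶠ T in atTop, (L.path T).im = T) ∧ ∀ᶠ T in atTop, (L.path (-T)).im = -T := by
  obtain ⟨R, hR, h1, h2⟩ := L.vertical_ends
  constructor <;> filter_upwards [eventually_ge_atTop R] with T hT
  · rw [h2 T hT]; simp
  · rw [h1 (-T) (by linarith)]; simp

lemma continuous_comp_path {L : MBContour} {F : ℂ → ℂ} {U : Set ℂ}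
    (hF : DifferentiableOn ℂ F U) (h : ∀ u, L.path u ∈ U) : Continuous fun u => F (L.path u) :=
  hF.continuousOn.comp_continuous L.continuous_path h

/-- A holomorphic function on the convex strip has a primitive, so only its values at the ends
matter, and the ends of both contours have eventually equal heights. -/
lemma tendsto_integralOn_sub_of_differentiableOn
    (h₁ : ∀ u, L₁.path u ∈ reStrip a b) (h₂ : ∀ u, L₂.path u ∈ reStrip a b) {F : ℂ → ℂ}
    (hF : DifferentiableOn ℂ F (reStrip a b)) (hlim : Tendsto F (stripAtInfty a b) (𝓝 0)) :
    Tendsto (fun T => L₁.integralOn F (-T) T - L₂.integralOn F (-T) T) atTop (𝓝 0) := by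
  obtain ⟨Φ, hΦ⟩ := (convex_reStrip a b).exists_forall_hasDerivWithinAt hF
  have hΦ' : ∀ s ∈ reStrip a b, HasDerivAt Φ (F s) s := fun s hs =>
    (hΦ s hs).hasDerivAt ((isOpen_reStrip a b).mem_nhds hs)
  have habs : Tendsto (fun T : ℝ => |T|) atTop atTop := tendsto_abs_atTop_atTop
  have t1 := tendsto_sub_of_hasDerivAt_reStrip hΦ' hlim (z := L₁.path) (w := L₂.path) h₁ h₂
    (by filter_upwards [L₁.eventually_im_path.1, L₂.eventually_im_path.1] with T e1 e2
        rw [e1, e2])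
    (habs.congr' (by filter_upwards [L₁.eventually_im_path.1] with T e1; rw [e1]))
  have t2 := tendsto_sub_of_hasDerivAt_reStrip hΦ' hlim (z := fun T => L₁.path (-T))
    (w := fun T => L₂.path (-T)) (fun T => h₁ _) (fun T => h₂ _)
    (by filter_upwards [L₁.eventually_im_path.2, L₂.eventually_im_path.2] with T e1 e2
        rw [e1, e2])
    (habs.congr' (by filter_upwards [L₁.eventually_im_path.2] with T e1; rw [e1, abs_neg]))
  have := t1.sub t2
  rw [sub_zero] at this
  refine this.congr fun T => ?_
  rw [L₁.integralOn_eq_sub (continuous_comp_path hF h₁)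
      (fun u => hΦ' _ (h₁ u)),
    L₂.integralOn_eq_sub (continuous_comp_path hF h₂)
      (fun u => hΦ' _ (h₂ u))]
  ring

/-- The primitive `-(s - p)⁻¹` tends to zero at both ends, so the coefficient of `(s - p)⁻²` never
contributes. -/
lemma tendsto_integralOn_inv_sq (L : MBContour) {p : ℂ} (hp : p ∉ range L.path) :
    Tendsto (fun T => L.integralOn (fun s => ((s - p) ^ 2)⁻¹) (-T) T) atTop (𝓝 0) := by
  have hne : ∀ u, L.path u - p ≠ 0 := fun u h => hp ⟨u, sub_eq_zero.1 h⟩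
  have e : ∀ T, L.integralOn (fun s => ((s - p) ^ 2)⁻¹) (-T) T =
      -(L.path T - p)⁻¹ - -(L.path (-T) - p)⁻¹ := fun T =>
    L.integralOn_eq_sub (Φ := fun s => -(s - p)⁻¹)
      (((L.continuous_path.sub continuous_const).pow 2).inv₀ fun u => pow_ne_zero _ (hne u))
      (fun u => by
        refine (((hasDerivAt_id (L.path u)).sub_const p).inv (hne u)).neg.congr_deriv ?_
        simp [neg_div]) _ _
  have lim : ∀ z : ℝ → ℂ, Tendsto (fun T => |(z T).im|) atTop atTop →
      Tendsto (fun T => (z T - p)⁻¹) atTop (𝓝 0) := by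
    intro z hz
    refine tendsto_inv₀_cobounded.comp (tendsto_norm_atTop_iff_cobounded.1 ?_)
    refine tendsto_atTop_mono (fun T => ?_) (tendsto_atTop_add_const_right _ (-|p.im|) hz)
    calc |(z T).im| + -|p.im| ≤ |(z T).im - p.im| := by
          linarith [abs_sub_abs_le_abs_sub (z T).im p.im]
      _ = |(z T - p).im| := by simp
      _ ≤ ‖z T - p‖ := Complex.abs_im_le_norm _
  have habs : Tendsto (fun T : ℝ => |T|) atTop atTop := tendsto_abs_atTop_atTop
  have t1 := lim L.path
    (habs.congr' (by filter_upwards [L.eventually_im_path.1] with T e1; rw [e1]))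
  have t2 := lim (fun T => L.path (-T))
    (habs.congr' (by filter_upwards [L.eventually_im_path.2] with T e1; rw [e1, abs_neg]))
  simp_rw [e]
  simpa using t1.neg.sub t2.neg

/-- The residue theorem for the difference of two contours in a strip: `w₁ p` and `w₂ p` are the
principal values of `∫ ds / (s - p)`. -/
theorem tendsto_integralOn_sub
    (h₁ : ∀ u, L₁.path u ∈ reStrip a b) (h₂ : ∀ u, L₂.path u ∈ reStrip a b)
    {P : Finset ℂ} {F c w₁ w₂ : ℂ → ℂ}
    (hF : DifferentiableOn ℂ F (reStrip a b \ P)) (hlim : Tendsto F (stripAtInfty a b) (𝓝 0))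
    (hP : ∀ p ∈ P, ∃ c₂, HasPrincipalPart F p c₂ (c p))
    (hr₁ : ∀ p ∈ P, p ∉ range L₁.path) (hr₂ : ∀ p ∈ P, p ∉ range L₂.path)
    (hw₁ : ∀ p ∈ P,
      Tendsto (fun T => L₁.integralOn (fun s => (s - p)⁻¹) (-T) T) atTop (𝓝 (w₁ p)))
    (hw₂ : ∀ p ∈ P,
      Tendsto (fun T => L₂.integralOn (fun s => (s - p)⁻¹) (-T) T) atTop (𝓝 (w₂ p))) :
    Tendsto (fun T => L₁.integralOn F (-T) T - L₂.integralOn F (-T) T) atTop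
      (𝓝 (∑ p ∈ P, c p * (w₁ p - w₂ p))) := by
  classical
  -- The poles are removed one at a time by subtracting the principal part, which itself tends to
  -- zero at the ends of the strip.
  induction P using Finset.induction_on generalizing F with
  | empty =>
    simpa using tendsto_integralOn_sub_of_differentiableOn h₁ h₂ (by simpa using hF) hlim
  | insert p P hp ih =>
    obtain ⟨c₂, e, he, hFe⟩ := hP p (by simp)
    set Q : ℂ → ℂ := fun s => c₂ * ((s - p) ^ 2)⁻¹ + c p * (s - p)⁻¹ with hQ
    have hQan : ∀ s ≠ p, AnalyticAt ℂ Q s := fun s hs => by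
      have : s - p ≠ 0 := sub_ne_zero.2 hs
      have : (s - p) ^ 2 ≠ 0 := pow_ne_zero _ this
      fun_prop (disch := assumption)
    have hQlim : Tendsto Q (stripAtInfty a b) (𝓝 0) := by
      have t := tendsto_sub_inv_stripAtInfty a b p
      have := ((t.mul t).const_mul c₂).add (t.const_mul (c p))
      simp only [mul_zero, add_zero] at this
      refine this.congr fun s => ?_
      simp only [hQ, sq, mul_inv]
    -- The value of `F - Q` at `p` itself is a junk value; replacing it by `e p` fills the removable
    -- singularity.
    set F' : ℂ → ℂ := Function.update (fun s => F s - Q s) p (e p) with hF'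
    have hF'ne : ∀ s ≠ p, F' s = F s - Q s := fun s hs => Function.update_of_ne hs _ _
    have hF'ev : ∀ s ≠ p, ∀ᶠ z in 𝓝 s, F' z = F z - Q z := fun s hs => by
      filter_upwards [isOpen_ne.mem_nhds hs] with z hz using hF'ne z hz
    have hF'p : F' =ᶠ[𝓝 p] e := by
      have h0 : ∀ᶠ s in 𝓝[≠] p, F' s = e s := by
        filter_upwards [hFe, self_mem_nhdsWithin] with s hs hne
        rw [hF'ne s hne, hs, hQ]
        ring
      rw [eventually_nhdsWithin_iff] at h0
      filter_upwards [h0] with s hs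
      by_cases h : s = p
      · rw [h, hF', Function.update_self]
      · exact hs h
    have hopen : ∀ P : Finset ℂ, IsOpen (reStrip a b \ (P : Set ℂ)) := fun P =>
      (isOpen_reStrip a b).sdiff P.finite_toSet.isClosed
    have hFd : DifferentiableOn ℂ F' (reStrip a b \ P) := by
      intro s hs
      apply DifferentiableAt.differentiableWithinAt
      by_cases h : s = p
      · rw [h]
        exact he.differentiableAt.congr_of_eventuallyEq hF'p
      · refine DifferentiableAt.congr_of_eventuallyEq ?_ (hF'ev s h)
        refine DifferentiableAt.sub ?_ (hQan s h).differentiableAt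
        exact hF.differentiableAt ((hopen _).mem_nhds ⟨hs.1, by simpa [h] using hs.2⟩)
    have hF'lim : Tendsto F' (stripAtInfty a b) (𝓝 0) := by
      have := hlim.sub hQlim
      rw [sub_zero] at this
      refine this.congr' (eventually_stripAtInfty.2 ⟨|p.im| + 1, fun s _ hs => ?_⟩)
      refine (hF'ne s ?_).symm
      rintro rfl
      linarith
    have hind := ih hFd hF'lim (fun q hq => by
        have hqp : q ≠ p := fun h => hp (h ▸ hq)
        obtain ⟨d, e', he', hFe'⟩ := hP q (by simp [hq])
        refine ⟨d, fun s => e' s - Q s, he'.sub (hQan q hqp), ?_⟩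
        filter_upwards [hFe', (hF'ev q hqp).filter_mono nhdsWithin_le_nhds] with s h1 h2
        rw [h2, h1]
        ring)
      (fun q hq => hr₁ q (by simp [hq])) (fun q hq => hr₂ q (by simp [hq]))
      (fun q hq => hw₁ q (by simp [hq])) (fun q hq => hw₂ q (by simp [hq]))
    have split : ∀ L : MBContour, (∀ u, L.path u ∈ reStrip a b) →
        (∀ q ∈ insert p P, q ∉ range L.path) → ∀ T, L.integralOn F (-T) T =
          L.integralOn F' (-T) T + (c₂ * L.integralOn (fun s => ((s - p) ^ 2)⁻¹) (-T) T
            + c p * L.integralOn (fun s => (s - p)⁻¹) (-T) T) := by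
      intro L hL hr T
      have hne : ∀ u, L.path u - p ≠ 0 := fun u h => hr p (by simp) ⟨u, sub_eq_zero.1 h⟩
      have i1 : Continuous fun u => F' (L.path u) := continuous_comp_path hFd
        fun u => ⟨hL u, fun hu => hr _ (by simp [Finset.mem_coe.1 hu]) ⟨u, rfl⟩⟩
      have i2 : Continuous fun u => ((L.path u - p) ^ 2)⁻¹ :=
        ((L.continuous_path.sub continuous_const).pow 2).inv₀ fun u => pow_ne_zero _ (hne u)
      have i3 : Continuous fun u => (L.path u - p)⁻¹ :=
        (L.continuous_path.sub continuous_const).inv₀ hne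
      unfold integralOn
      rw [← intervalIntegral.integral_const_mul, ← intervalIntegral.integral_const_mul,
        ← intervalIntegral.integral_add, ← intervalIntegral.integral_add]
      · refine intervalIntegral.integral_congr fun u _ => ?_
        simp only
        rw [hF'ne _ (sub_ne_zero.1 (hne u)), hQ]
        ring
      · exact L.intervalIntegrable_mul_deriv i1 _ _
      · exact ((L.intervalIntegrable_mul_deriv i2 _ _).const_mul _).add
          ((L.intervalIntegrable_mul_deriv i3 _ _).const_mul _)
      · exact (L.intervalIntegrable_mul_deriv i2 _ _).const_mul _
      · exact (L.intervalIntegrable_mul_deriv i3 _ _).const_mul _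
    have s1 := L₁.tendsto_integralOn_inv_sq (hr₁ p (by simp))
    have s2 := L₂.tendsto_integralOn_inv_sq (hr₂ p (by simp))
    have v1 := hw₁ p (by simp)
    have v2 := hw₂ p (by simp)
    have tot := hind.add (((s1.const_mul c₂).add (v1.const_mul (c p))).sub
      ((s2.const_mul c₂).add (v2.const_mul (c p))))
    rw [Finset.sum_insert hp]
    convert! tot using 2
    · rw [split L₁ h₁ hr₁, split L₂ h₂ hr₂]; ring
    · ring

/-- The vertical line through `c`. -/
def verticalLine (c : ℝ) : MBContour where
  path u := c + u * Complex.I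
  continuous_path := by fun_prop
  piecewise_C1 := ⟨∅, fun a b _ _ => by
    have : ContDiff ℝ 1 fun u : ℝ => (c : ℂ) + u * Complex.I :=
      contDiff_const.add (Complex.ofRealCLM.contDiff.mul contDiff_const)
    exact this.contDiffOn⟩
  lo := c
  hi := c
  vertical_ends := ⟨1, one_pos, fun _ _ => rfl, fun _ _ => rfl⟩

@[simp] lemma verticalLine_path_re (c u : ℝ) : ((verticalLine c).path u).re = c := by
  simp [verticalLine]

lemma mem_leftSide_of_re_lt {L : MBContour} {p : ℂ} (h : ∀ u, p.re < (L.path u).re) :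
    p ∈ L.leftSide :=
  ⟨p, h, JoinedIn.refl fun ⟨u, hu⟩ => by have := h u; rw [hu] at this; exact lt_irrefl _ this⟩

lemma mem_rightSide_of_lt_re {L : MBContour} {p : ℂ} (h : ∀ u, (L.path u).re < p.re) :
    p ∈ L.rightSide :=
  ⟨p, h, JoinedIn.refl fun ⟨u, hu⟩ => by have := h u; rw [hu] at this; exact lt_irrefl _ this⟩

/-- Shifting a contour to a vertical line further left picks up the residues at the poles on the
left of the contour. -/
theorem tendsto_integralOn_sub_verticalLine {L : MBContour} {c : ℝ}
    (h₁ : ∀ u, L.path u ∈ reStrip a b) (hc : c ∈ Ioo a b) {Pl Pr : Finset ℂ} {F ρ : ℂ → ℂ}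
    (hF : DifferentiableOn ℂ F (reStrip a b \ (Pl ∪ Pr)))
    (hlim : Tendsto F (stripAtInfty a b) (𝓝 0))
    (hPl : ∀ p ∈ Pl, p ∈ L.leftSide ∧ c < p.re ∧ ∃ c₂, HasPrincipalPart F p c₂ (ρ p))
    (hPr : ∀ p ∈ Pr, p ∈ L.rightSide ∧ c < p.re ∧ ∃ c₂ c₁, HasPrincipalPart F p c₂ c₁) :
    Tendsto (fun T => L.integralOn F (-T) T - (verticalLine c).integralOn F (-T) T) atTop
      (𝓝 (2 * Real.pi * Complex.I * ∑ p ∈ Pl, ρ p)) := by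
  classical
  have hpp : ∀ p ∈ Pl ∪ Pr, ∃ c₂ c₁, HasPrincipalPart F p c₂ c₁ ∧ (p ∈ Pl → c₁ = ρ p) := by
    intro p hp
    by_cases h : p ∈ Pl
    · obtain ⟨-, -, c₂, h2⟩ := hPl p h
      exact ⟨c₂, ρ p, h2, fun _ => rfl⟩
    · obtain ⟨-, -, c₂, c₁, h2⟩ := hPr p ((Finset.mem_union.1 hp).resolve_left h)
      exact ⟨c₂, c₁, h2, fun h' => absurd h' h⟩
  choose! c₂ c₁ hcc hcρ using hpp
  have hline : ∀ p ∈ Pl ∪ Pr, p ∈ (verticalLine c).rightSide := fun p hp =>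
    mem_rightSide_of_lt_re fun u => by
      rw [verticalLine_path_re]
      rcases Finset.mem_union.1 hp with h | h
      exacts [(hPl p h).2.1, (hPr p h).2.1]
  -- All poles lie to the right of the line and have weight `-πi` there. The difference of weights
  -- is thus `2πi` for poles on the left of `L` and `0` for those on its right.
  have key := tendsto_integralOn_sub (L₁ := L) (L₂ := verticalLine c) (P := Pl ∪ Pr) (c := c₁)
    (w₁ := fun p => if p ∈ Pl then Real.pi * Complex.I else -(Real.pi * Complex.I))
    (w₂ := fun _ => -(Real.pi * Complex.I)) h₁
    (fun u => by simpa [reStrip] using hc) (by simpa using hF) hlim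
    (fun p hp => ⟨c₂ p, hcc p hp⟩)
    (fun p hp => by
      rcases Finset.mem_union.1 hp with h | h
      exacts [not_mem_range_of_mem_leftSide (hPl p h).1,
        not_mem_range_of_mem_rightSide (hPr p h).1])
    (fun p hp => not_mem_range_of_mem_rightSide (hline p hp))
    (fun p hp => by
      by_cases h : p ∈ Pl
      · simp only [h, if_true]
        exact L.tendsto_integralOn_inv_of_mem_leftSide (hPl p h).1
      · simp only [h, if_false]
        exact L.tendsto_integralOn_inv_of_mem_rightSide
          (hPr p ((Finset.mem_union.1 hp).resolve_left h)).1)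
    (fun p hp => (verticalLine c).tendsto_integralOn_inv_of_mem_rightSide (hline p hp))
  convert! key using 2
  rw [Finset.mul_sum, ← Finset.sum_subset (Finset.subset_union_left (s₁ := Pl) (s₂ := Pr))]
  · refine Finset.sum_congr rfl fun p hp => ?_
    rw [if_pos hp, hcρ p (Finset.mem_union_left _ hp) hp]
    ring
  · intro p _ hp
    rw [if_neg hp]
    ring

end MBContour

/-! ### Exponential decay and integrals over whole contours -/

/-- Exponential decay along vertical lines, uniformly in vertical strips of finite width. -/
def VerticalExpDecay (F : ℂ → ℂ) : Prop :=
  ∀ a b : ℝ, ∃ C : ℝ, ∀ s : ℂ, a ≤ s.re → s.re ≤ b → 1 ≤ |s.im| →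
    ‖F s‖ ≤ C * Real.exp (-|s.im|)

lemma Real.rpow_le_rpow_add_rpow {y a b x : ℝ} (hy : 0 < y) (ha : a ≤ x) (hb : x ≤ b) :
    y ^ x ≤ y ^ a + y ^ b := by
  rcases le_total y 1 with h | h
  · linarith [Real.rpow_le_rpow_of_exponent_ge hy h ha, Real.rpow_pos_of_pos hy b]
  · linarith [Real.rpow_le_rpow_of_exponent_le h hb, Real.rpow_pos_of_pos hy a]

lemma norm_ofReal_cpow_neg {y : ℝ} (hy : 0 < y) (s : ℂ) : ‖(y : ℂ) ^ (-s)‖ = y ^ (-s.re) := by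
  rw [Complex.norm_cpow_eq_rpow_re_of_pos hy, Complex.neg_re]

lemma VerticalExpDecay.mul_cpow {F : ℂ → ℂ} (hF : VerticalExpDecay F) {y : ℝ} (hy : 0 < y) :
    VerticalExpDecay fun s => F s * (y : ℂ) ^ (-s) := by
  intro a b
  obtain ⟨C, hC⟩ := hF a b
  refine ⟨C * (y ^ (-b) + y ^ (-a)), fun s h1 h2 h3 => ?_⟩
  have h0 := hC s h1 h2 h3
  rw [norm_mul, norm_ofReal_cpow_neg hy]
  calc _ ≤ (C * Real.exp (-|s.im|)) * (y ^ (-b) + y ^ (-a)) :=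
        mul_le_mul h0 (Real.rpow_le_rpow_add_rpow hy (by linarith) (by linarith))
          (Real.rpow_nonneg hy.le _) ((norm_nonneg _).trans h0)
    _ = _ := by ring

lemma VerticalExpDecay.tendsto {F : ℂ → ℂ} (hF : VerticalExpDecay F) (a b : ℝ) :
    Tendsto F (stripAtInfty a b) (𝓝 0) := by
  obtain ⟨C, hC⟩ := hF a b
  have h : Tendsto (fun s : ℂ => C * Real.exp (-|s.im|)) (stripAtInfty a b) (𝓝 0) := by
    have : Tendsto (fun s : ℂ => |s.im|) (stripAtInfty a b) atTop :=
      tendsto_comap.mono_left inf_le_left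
    simpa using (Real.tendsto_exp_neg_atTop_nhds_zero.comp this).const_mul C
  exact squeeze_zero_norm' (eventually_stripAtInfty.2
    ⟨1, fun s hs h1 => hC s hs.1.le hs.2.le h1⟩) h

lemma integrable_exp_neg_abs : Integrable fun u : ℝ => Real.exp (-|u|) := by
  have h1 : IntegrableOn (fun u : ℝ => Real.exp (-|u|)) (Ioi 0) :=
    (integrableOn_exp_neg_Ioi 0).congr_fun
      (fun u (hu : 0 < u) => by simp only [abs_of_pos hu]) measurableSet_Ioi
  have h2 : IntegrableOn (fun u : ℝ => Real.exp (-|u|)) (Iic 0) :=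
    (integrableOn_exp_Iic 0).congr_fun
      (fun u (hu : u ≤ 0) => by simp only [abs_of_nonpos hu, neg_neg]) measurableSet_Iic
  rw [← integrableOn_univ, ← Iic_union_Ioi (a := (0 : ℝ))]
  exact h2.union h1

namespace MBContour

variable (L : MBContour)

/-- The integral of `F` over the contour. -/
def integral (F : ℂ → ℂ) : ℂ := ∫ u, F (L.path u) * deriv L.path u

/-- On the vertical ends the derivative is `i` and the ordinate is `u`, so the decay is exponential
in `|u|`; elsewhere a continuous function multiplies a locally integrable one. -/
lemma integrable_mul_deriv {F : ℂ → ℂ} (hc : Continuous fun u => F (L.path u))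
    (hF : VerticalExpDecay F) : Integrable fun u => F (L.path u) * deriv L.path u := by
  obtain ⟨R, hR, h1, h2, hd⟩ := L.exists_deriv_eq_I
  obtain ⟨a, b, -, -, hab⟩ := L.exists_re_bounds
  obtain ⟨C, hC⟩ := hF a b
  have hloc : LocallyIntegrable fun u => F (L.path u) * deriv L.path u := by
    rw [locallyIntegrable_iff]
    exact fun k hk => (L.locallyIntegrable_deriv.integrableOn_isCompact hk).continuousOn_mul
      hc.continuousOn hk
  have hbound : ∀ u, max (R + 1) 1 ≤ |u| →
      ‖F (L.path u) * deriv L.path u‖ ≤ C * ‖Real.exp (-|u|)‖ := by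
    intro u hu
    have him : (L.path u).im = u := by
      rcases le_abs.1 ((le_max_left _ _).trans hu) with h | h
      · rw [h2 u (by linarith)]; simp
      · rw [h1 u (by linarith)]; simp
    rw [norm_mul, hd u (by linarith [(le_max_left _ _).trans hu]), Complex.norm_I, mul_one,
      Real.norm_of_nonneg (Real.exp_pos _).le]
    have := hC (L.path u) (hab u).1 (hab u).2 (by rw [him]; exact (le_max_right _ _).trans hu)
    rwa [him] at this
  refine hloc.integrable_of_isBigO_atBot_atTop
    (g := fun u : ℝ => Real.exp (-|u|)) (g' := fun u : ℝ => Real.exp (-|u|)) ?_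
    (integrable_exp_neg_abs.integrableAtFilter _) ?_ (integrable_exp_neg_abs.integrableAtFilter _)
  · refine Asymptotics.IsBigO.of_bound C ?_
    filter_upwards [tendsto_abs_atBot_atTop.eventually_ge_atTop _] with u hu using hbound u hu
  · refine Asymptotics.IsBigO.of_bound C ?_
    filter_upwards [tendsto_abs_atTop_atTop.eventually_ge_atTop _] with u hu using hbound u hu

lemma tendsto_integralOn {F : ℂ → ℂ} (hc : Continuous fun u => F (L.path u))
    (hF : VerticalExpDecay F) :
    Tendsto (fun T => L.integralOn F (-T) T) atTop (𝓝 (L.integral F)) :=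
  intervalIntegral_tendsto_integral (L.integrable_mul_deriv hc hF) tendsto_neg_atTop_atBot
    tendsto_id

theorem integral_sub_verticalLine {L : MBContour} {a b c : ℝ}
    (h₁ : ∀ u, L.path u ∈ reStrip a b) (hc : c ∈ Ioo a b) {Pl Pr : Finset ℂ} {F ρ : ℂ → ℂ}
    (hF : DifferentiableOn ℂ F (reStrip a b \ (Pl ∪ Pr))) (hdec : VerticalExpDecay F)
    (hPl : ∀ p ∈ Pl, p ∈ L.leftSide ∧ c < p.re ∧ ∃ c₂, HasPrincipalPart F p c₂ (ρ p))
    (hPr : ∀ p ∈ Pr, p ∈ L.rightSide ∧ c < p.re ∧ ∃ c₂ c₁, HasPrincipalPart F p c₂ c₁) :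
    L.integral F =
      (verticalLine c).integral F + 2 * Real.pi * Complex.I * ∑ p ∈ Pl, ρ p := by
  have h1 := L.tendsto_integralOn (continuous_comp_path hF fun u => ⟨h₁ u, fun hu => by
    rcases hu with hu | hu
    exacts [not_mem_range_of_mem_leftSide (hPl _ hu).1 ⟨u, rfl⟩,
      not_mem_range_of_mem_rightSide (hPr _ hu).1 ⟨u, rfl⟩]⟩) hdec
  have h2 := (verticalLine c).tendsto_integralOn (continuous_comp_path hF fun u =>
    ⟨by simpa [reStrip] using hc, fun hu => by
      rcases hu with hu | hu
      · have := (hPl _ hu).2.1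
        simp at this
      · have := (hPr _ hu).2.1
        simp at this⟩) hdec
  have := tendsto_nhds_unique (h1.sub h2)
    (tendsto_integralOn_sub_verticalLine h₁ hc hF (hdec.tendsto a b) hPl hPr)
  linear_combination this

lemma integral_verticalLine (c : ℝ) (F : ℂ → ℂ) :
    (verticalLine c).integral F = ∫ u : ℝ, F (c + u * Complex.I) * Complex.I := by
  have : ∀ u : ℝ, deriv (verticalLine c).path u = Complex.I := fun u => by
    have h : HasDerivAt (fun u : ℝ => (c : ℂ) + (u : ℂ) * Complex.I) Complex.I u := by
      simpa using ((hasDerivAt_id (u : ℂ)).comp_ofReal.mul_const Complex.I).const_add (c : ℂ)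
    exact h.deriv
  unfold integral
  simp_rw [this]
  rfl

end MBContour

/-! ### Mellin–Barnes representation of `log (1 + y)` -/

lemma Complex.sinh_abs_im_le_norm_sin (z : ℂ) : Real.sinh |z.im| ≤ ‖Complex.sin z‖ := by
  have e : Complex.sin z = (Complex.exp (-z * Complex.I) - Complex.exp (z * Complex.I))
      * (Complex.I / 2) := by rw [Complex.sin]; ring
  have n1 : ‖Complex.exp (-z * Complex.I)‖ = Real.exp z.im := by simp [Complex.norm_exp]
  have n2 : ‖Complex.exp (z * Complex.I)‖ = Real.exp (-z.im) := by simp [Complex.norm_exp]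
  rw [e, norm_mul, norm_div, Complex.norm_I, Complex.norm_ofNat, Real.sinh_eq]
  have h := abs_norm_sub_norm_le (Complex.exp (-z * Complex.I)) (Complex.exp (z * Complex.I))
  rw [n1, n2] at h
  have : Real.exp |z.im| - Real.exp (-|z.im|) ≤ |Real.exp z.im - Real.exp (-z.im)| := by
    rcases abs_cases z.im with ⟨h, -⟩ | ⟨h, -⟩ <;> rw [h]
    · exact le_abs_self _
    · rw [neg_neg, ← abs_neg, neg_sub]; exact le_abs_self _
  linarith

/-- The kernel `π / (s sin (π s))`, whose inverse Mellin transform is `log (1 + y)`. -/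
def logKernel (s : ℂ) : ℂ := Real.pi / (s * Complex.sin (Real.pi * s))

lemma exp_div_four_le_sinh {t : ℝ} (ht : 1 ≤ t) : Real.exp t / 4 ≤ Real.sinh t := by
  rw [Real.sinh_eq]
  have h1 : Real.exp (-t) ≤ 1 := Real.exp_le_one_iff.2 (by linarith)
  have h2 := Real.add_one_le_exp t
  linarith

lemma norm_logKernel_le {s : ℂ} (h : 1 ≤ |s.im|) :
    ‖logKernel s‖ ≤ 4 * Real.pi * Real.exp (-|s.im|) := by
  have hs1 : 1 ≤ ‖s‖ := h.trans (Complex.abs_im_le_norm s)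
  have hpi : 1 ≤ Real.pi := by linarith [Real.pi_gt_three]
  have him : |(Real.pi * s : ℂ).im| = Real.pi * |s.im| := by
    simp [abs_mul, abs_of_pos Real.pi_pos]
  have h2 : |s.im| ≤ Real.pi * |s.im| := by nlinarith
  have hs2 : Real.exp |s.im| / 4 ≤ ‖Complex.sin (Real.pi * s)‖ := by
    refine le_trans ?_ (Complex.sinh_abs_im_le_norm_sin _)
    rw [him]
    exact (exp_div_four_le_sinh h).trans (Real.sinh_le_sinh.2 h2)
  rw [logKernel, norm_div, norm_mul, Complex.norm_real, Real.norm_of_nonneg Real.pi_pos.le,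
    div_le_iff₀ (by have := Real.exp_pos |s.im|; nlinarith)]
  have h3 : Real.exp |s.im| / 4 ≤ ‖s‖ * ‖Complex.sin (Real.pi * s)‖ := by
    nlinarith [Real.exp_pos |s.im|, norm_nonneg (Complex.sin (Real.pi * s))]
  calc Real.pi = 4 * Real.pi * Real.exp (-|s.im|) * (Real.exp |s.im| / 4) := by
        rw [Real.exp_neg]; field_simp
    _ ≤ _ := by gcongr

lemma verticalExpDecay_logKernel : VerticalExpDecay logKernel :=
  fun _ _ => ⟨4 * Real.pi, fun _ _ _ h => norm_logKernel_le h⟩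

lemma differentiableAt_logKernel_mul_cpow {y : ℝ} (hy : 0 < y) {s : ℂ} (h : ∀ n : ℤ, s ≠ n) :
    DifferentiableAt ℂ (fun s => logKernel s * (y : ℂ) ^ (-s)) s := by
  have h0 : s ≠ 0 := by simpa using h 0
  have h1 := sin_pi_mul_ne_zero (x := s) fun ⟨n, hn⟩ => h n hn.symm
  have hd : s * Complex.sin (Real.pi * s) ≠ 0 := mul_ne_zero h0 h1
  have hy' : (y : ℂ) ≠ 0 := Complex.ofReal_ne_zero.2 hy.ne'
  unfold logKernel
  refine DifferentiableAt.mul (by fun_prop (disch := assumption)) ?_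
  exact differentiableAt_id.neg.const_cpow (Or.inl hy')

lemma analyticAt_ofReal_cpow_neg {y : ℝ} (hy : 0 < y) (p : ℂ) :
    AnalyticAt ℂ (fun s : ℂ => (y : ℂ) ^ (-s)) p := by
  have hy' : (y : ℂ) ≠ 0 := Complex.ofReal_ne_zero.2 hy.ne'
  refine Differentiable.analyticAt (fun s => ?_) p
  exact differentiableAt_id.neg.const_cpow (Or.inl hy')

lemma hasDerivAt_sin_pi_mul (n : ℤ) :
    HasDerivAt (fun s : ℂ => Complex.sin (Real.pi * s)) ((-1) ^ n * Real.pi) (n : ℂ) := by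
  have := (((hasDerivAt_id (n : ℂ)).const_mul (Real.pi : ℂ))).csin
  refine this.congr_deriv ?_
  simp only [id, mul_one]
  rw [mul_comm (Real.pi : ℂ) n]
  have := congrArg (fun x : ℝ => (x : ℂ)) (Real.cos_int_mul_pi n)
  push_cast at this
  rw [this]

/-- The simple zero at `n` is split off with an analytic cofactor, nonzero at `n`, so that poles of
quotients by the sine can be read off. -/
lemma sin_pi_mul_eq_sub_mul_dslope (n : ℤ) (s : ℂ) : Complex.sin (Real.pi * s) =
    (s - n) * dslope (fun s : ℂ => Complex.sin (Real.pi * s)) n s := by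
  have := sub_smul_dslope (fun s : ℂ => Complex.sin (Real.pi * s)) n s
  rw [smul_eq_mul] at this
  rw [this, mul_comm (Real.pi : ℂ) n, Complex.sin_int_mul_pi, sub_zero]

lemma analyticAt_dslope_sin_pi_mul (n : ℤ) :
    AnalyticAt ℂ (dslope (fun s : ℂ => Complex.sin (Real.pi * s)) n) n :=
  analyticAt_dslope (Differentiable.analyticAt (by fun_prop) _)

lemma dslope_sin_pi_mul_self (n : ℤ) :
    dslope (fun s : ℂ => Complex.sin (Real.pi * s)) n n = (-1) ^ n * Real.pi := by
  rw [dslope_same, (hasDerivAt_sin_pi_mul n).deriv]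

lemma dslope_sin_pi_mul_self_ne_zero (n : ℤ) :
    dslope (fun s : ℂ => Complex.sin (Real.pi * s)) n n ≠ 0 := by
  rw [dslope_sin_pi_mul_self]
  exact mul_ne_zero (zpow_ne_zero _ (by norm_num)) (Complex.ofReal_ne_zero.2 Real.pi_ne_zero)

lemma hasPrincipalPart_logKernel_int {y : ℝ} (hy : 0 < y) {n : ℤ} (hn : n ≠ 0) :
    HasPrincipalPart (fun s => logKernel s * (y : ℂ) ^ (-s)) n 0
      ((-1) ^ n * (y : ℂ) ^ (-(n : ℂ)) / n) := by
  have hn' : (n : ℂ) ≠ 0 := by exact_mod_cast hn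
  have hD := dslope_sin_pi_mul_self_ne_zero n
  have h := hasPrincipalPart_of_eq_div (F := fun s => logKernel s * (y : ℂ) ^ (-s)) (p := n)
    (h := fun s => Real.pi * (y : ℂ) ^ (-s) /
      (s * dslope (fun s : ℂ => Complex.sin (Real.pi * s)) n s))
    ((analyticAt_const.mul (analyticAt_ofReal_cpow_neg hy _)).div
      (analyticAt_id.mul (analyticAt_dslope_sin_pi_mul n)) (mul_ne_zero hn' hD))
    (by
      filter_upwards with s
      rw [logKernel, sin_pi_mul_eq_sub_mul_dslope n s, ← mul_div_right_comm, div_div]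
      ring_nf)
  convert! h using 1
  rw [dslope_sin_pi_mul_self]
  have h1 : ((-1 : ℂ) ^ n) * (-1) ^ n = 1 := by rw [← mul_zpow]; simp
  have hpi : (Real.pi : ℂ) ≠ 0 := Complex.ofReal_ne_zero.2 Real.pi_ne_zero
  have h2 : ((-1 : ℂ) ^ n) ≠ 0 := zpow_ne_zero _ (by norm_num)
  field_simp
  linear_combination (y : ℂ) ^ (-(n : ℂ)) * h1

/-- The pole is double. The cofactor `S = sin(πs)/s` is even, hence `S'(0) = 0`, and only the
derivative `-log y` of `y⁻ˢ` enters the residue. -/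
lemma hasPrincipalPart_logKernel_zero {y : ℝ} (hy : 0 < y) :
    ∃ c₂, HasPrincipalPart (fun s => logKernel s * (y : ℂ) ^ (-s)) 0 c₂ (-Real.log y) := by
  have hD := dslope_sin_pi_mul_self_ne_zero 0
  have hA := analyticAt_dslope_sin_pi_mul 0
  have hV := dslope_sin_pi_mul_self 0
  have hE := sin_pi_mul_eq_sub_mul_dslope 0
  simp only [Int.cast_zero, zpow_zero, one_mul, sub_zero] at hD hA hV hE
  set S := dslope (fun s : ℂ => Complex.sin (Real.pi * s)) 0 with hS
  have hpi : (Real.pi : ℂ) ≠ 0 := Complex.ofReal_ne_zero.2 Real.pi_ne_zero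
  have hSe : (fun s => S (-s)) = S := by
    funext s
    by_cases h : s = 0
    · rw [h, neg_zero]
    · apply mul_left_cancel₀ (neg_ne_zero.2 h)
      rw [← hE, neg_mul, ← hE, mul_neg, Complex.sin_neg]
  have hS' : deriv S 0 = 0 := by
    have := deriv_comp_neg (f := S) 0
    rw [hSe, neg_zero] at this
    exact self_eq_neg.1 this
  have h := hasPrincipalPart_of_eq_div_sq (F := fun s => logKernel s * (y : ℂ) ^ (-s)) (p := 0)
    (h := fun s => Real.pi * (y : ℂ) ^ (-s) / S s)
    ((analyticAt_const.mul (analyticAt_ofReal_cpow_neg hy _)).div hA hD)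
    (by
      filter_upwards with s
      rw [logKernel, hE s, sub_zero, ← mul_div_right_comm, div_div]
      ring_nf)
  refine ⟨Real.pi * (y : ℂ) ^ (-(0 : ℂ)) / S 0, ?_⟩
  convert! h using 1
  have hy' : (y : ℂ) ≠ 0 := Complex.ofReal_ne_zero.2 hy.ne'
  have d1 : HasDerivAt (fun s : ℂ => (y : ℂ) ^ (-s)) (-Complex.log y) 0 := by
    refine ((hasDerivAt_id (0 : ℂ)).neg.const_cpow (Or.inl hy')).congr_deriv ?_
    simp
  have d2 := hA.differentiableAt.hasDerivAt
  rw [hS'] at d2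
  refine Eq.trans ?_ ((d1.const_mul (Real.pi : ℂ)).div d2 hD).deriv.symm
  rw [hV, Complex.ofReal_log hy.le]
  simp
  field_simp

/-- At a half-integer abscissa the cosine vanishes and the sine is `±1`, so the real part has
modulus `cosh(πu)`, independently of `N`. -/
lemma one_le_norm_sin_half_integer_line (N : ℕ) (u : ℝ) :
    1 ≤ ‖Complex.sin (Real.pi * (((-N - 1 / 2 : ℝ) : ℂ) + u * Complex.I))‖ := by
  have e : (Real.pi * (((-N - 1 / 2 : ℝ) : ℂ) + u * Complex.I) : ℂ) =
      ((Real.pi * (-N - 1 / 2) : ℝ) : ℂ) + ((Real.pi * u : ℝ) : ℂ) * Complex.I := by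
    push_cast; ring
  have hcos : Real.cos (Real.pi * (-N - 1 / 2)) = 0 :=
    Real.cos_eq_zero_iff.2 ⟨-N - 1, by push_cast; ring⟩
  have hsin : |Real.sin (Real.pi * (-N - 1 / 2))| = 1 := by
    have h := Real.sin_sq_add_cos_sq (Real.pi * (-N - 1 / 2))
    rw [hcos] at h
    rw [← sq_eq_sq₀ (abs_nonneg _) zero_le_one, sq_abs]
    linarith
  refine le_trans ?_ (Complex.abs_re_le_norm _)
  rw [e, Complex.sin_add_mul_I, ← Complex.ofReal_sin, ← Complex.ofReal_cos, hcos,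
    ← Complex.ofReal_cosh, ← Complex.ofReal_mul]
  simp only [Complex.ofReal_zero, zero_mul, add_zero, Complex.ofReal_re]
  rw [abs_mul, hsin, one_mul]
  exact (Real.one_le_cosh _).trans (le_abs_self _)

/-- For `|u| < 1`, `|s| ≥ 1/2` and `|sin πs| ≥ 1` give the bound `2π`, and `exp(-|u|) ≥ 1/3`; hence
the constant `6π`. -/
lemma norm_logKernel_half_integer_line_le (N : ℕ) (u : ℝ) :
    ‖logKernel (((-N - 1 / 2 : ℝ) : ℂ) + u * Complex.I)‖ ≤ 6 * Real.pi * Real.exp (-|u|) := by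
  set s : ℂ := ((-N - 1 / 2 : ℝ) : ℂ) + u * Complex.I with hs
  have him : s.im = u := by simp [hs]
  have hpi := Real.pi_pos
  rcases le_or_gt 1 |u| with h | h
  · have := norm_logKernel_le (s := s) (by rwa [him])
    rw [him] at this
    refine this.trans ?_
    gcongr
    norm_num
  · have h1 : 1 / 2 ≤ ‖s‖ := by
      refine le_trans ?_ (Complex.abs_re_le_norm _)
      have : s.re = -N - 1 / 2 := by simp [hs]
      rw [this, le_abs]
      right
      have : (0 : ℝ) ≤ N := N.cast_nonneg
      linarith
    have h2 := one_le_norm_sin_half_integer_line N u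
    have h3 : 1 / 3 ≤ Real.exp (-|u|) := by
      have : Real.exp (-1) ≤ Real.exp (-|u|) := Real.exp_le_exp.2 (by linarith)
      refine le_trans ?_ this
      rw [Real.exp_neg, one_div]
      exact inv_anti₀ (Real.exp_pos 1) (by linarith [Real.exp_one_lt_d9])
    rw [logKernel, norm_div, norm_mul, Complex.norm_real, Real.norm_of_nonneg hpi.le,
      div_le_iff₀ (by nlinarith)]
    have h4 : 1 / 2 ≤ ‖s‖ * ‖Complex.sin (Real.pi * s)‖ := by nlinarith
    calc Real.pi = 6 * Real.pi * (1 / 3) * (1 / 2) := by ring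
      _ ≤ _ := by gcongr

namespace MBContour

/-- The contour separates `-1, -2, …` on its left from `0, 1, 2, …` on its right. -/
def SeparatesIntegers (L : MBContour) : Prop :=
  (∀ n : ℕ, -1 - (n : ℂ) ∈ L.leftSide) ∧ ∀ n : ℕ, (n : ℂ) ∈ L.rightSide

variable {L : MBContour}

lemma SeparatesIntegers.ne_intCast (hL : L.SeparatesIntegers) (u : ℝ) (n : ℤ) :
    L.path u ≠ n := by
  intro h
  obtain ⟨k, rfl | rfl⟩ := n.eq_nat_or_neg
  · exact not_mem_range_of_mem_rightSide (hL.2 k) ⟨u, by simpa using h⟩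
  · cases k with
    | zero => exact not_mem_range_of_mem_rightSide (hL.2 0) ⟨u, by simpa using h⟩
    | succ k =>
      exact not_mem_range_of_mem_leftSide (hL.1 k) ⟨u, by rw [h]; push_cast; ring⟩

lemma SeparatesIntegers.continuous_logKernel (hL : L.SeparatesIntegers) {y : ℝ} (hy : 0 < y) :
    Continuous fun u => logKernel (L.path u) * (y : ℂ) ^ (-L.path u) :=
  continuous_iff_continuousAt.2 fun u =>
    (differentiableAt_logKernel_mul_cpow hy (hL.ne_intCast u)).continuousAt.comp
      (f := L.path) L.continuous_path.continuousAt

lemma SeparatesIntegers.eventually_integral_logKernel (hL : L.SeparatesIntegers)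
    {y : ℝ} (hy : 0 < y) : ∀ᶠ N : ℕ in atTop,
      L.integral (fun s => logKernel s * (y : ℂ) ^ (-s)) =
        (verticalLine (-N - 1 / 2)).integral (fun s => logKernel s * (y : ℂ) ^ (-s)) +
          2 * Real.pi * Complex.I *
            ∑ n ∈ Finset.range N, (-1) ^ n * (y : ℂ) ^ (n + 1) / (n + 1) := by
  classical
  obtain ⟨A, B, -, -, hAB⟩ := L.exists_re_bounds
  obtain ⟨K, hK⟩ := exists_nat_gt B
  filter_upwards [eventually_ge_atTop ⌈-A⌉₊] with N hN
  have hNA : -A ≤ N := Nat.ceil_le.1 hN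
  -- The cosine interpolates `(-1)ⁿ`, so that the residue is a function of the pole rather than of
  -- its index.
  set ρ : ℂ → ℂ := fun p => Complex.cos (p * Real.pi) * (y : ℂ) ^ (-p) / p with hρ
  have hρint : ∀ n : ℤ, ρ n = (-1) ^ n * (y : ℂ) ^ (-(n : ℂ)) / n := fun n => by
    have := congrArg (fun x : ℝ => (x : ℂ)) (Real.cos_int_mul_pi n)
    push_cast at this
    simp only [hρ, this]
  have key := integral_sub_verticalLine (L := L) (a := -N - 1) (b := K + 1) (c := -N - 1 / 2)
    (Pl := (Finset.range N).image fun n : ℕ => -1 - (n : ℂ))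
    (Pr := (Finset.range (K + 1)).image fun n : ℕ => (n : ℂ))
    (F := fun s => logKernel s * (y : ℂ) ^ (-s)) (ρ := ρ)
    (fun u => ⟨by linarith [(hAB u).1], by linarith [(hAB u).2]⟩)
    ⟨by linarith, by
      have : (0 : ℝ) ≤ N := N.cast_nonneg
      have : (0 : ℝ) ≤ K := K.cast_nonneg
      linarith⟩
    (fun s hs => by
      apply DifferentiableAt.differentiableWithinAt
      apply differentiableAt_logKernel_mul_cpow hy
      rintro n rfl
      obtain ⟨⟨h1, h2⟩, h3⟩ := hs
      apply h3
      simp only [Complex.intCast_re] at h1 h2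
      have h1' : -(N : ℤ) - 1 < n := by exact_mod_cast h1
      have h2' : n < (K : ℤ) + 1 := by exact_mod_cast h2
      rcases le_or_gt 0 n with h0 | h0
      · right
        obtain ⟨k, rfl⟩ := Int.eq_ofNat_of_zero_le h0
        simp only [Finset.coe_image, mem_image, Finset.coe_range, mem_Iio]
        exact ⟨k, by omega, by simp⟩
      · left
        obtain ⟨k, hk⟩ := Int.eq_ofNat_of_zero_le (show 0 ≤ -n - 1 by omega)
        obtain rfl : n = -1 - k := by omega
        simp only [Finset.coe_image, mem_image, Finset.coe_range, mem_Iio]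
        exact ⟨k, by omega, by push_cast; ring⟩)
    (verticalExpDecay_logKernel.mul_cpow hy)
    (fun p hp => by
      obtain ⟨n, hn, rfl⟩ := Finset.mem_image.1 hp
      refine ⟨hL.1 n, ?_, 0, ?_⟩
      · have : (n : ℝ) + 1 ≤ N := by exact_mod_cast Finset.mem_range.1 hn
        simp
        linarith
      · have := hasPrincipalPart_logKernel_int hy (n := -1 - n) (by omega)
        rw [← hρint] at this
        exact_mod_cast this)
    (fun p hp => by
      obtain ⟨n, hn, rfl⟩ := Finset.mem_image.1 hp
      refine ⟨hL.2 n, ?_, ?_⟩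
      · have : (0 : ℝ) ≤ N := N.cast_nonneg
        have : (0 : ℝ) ≤ n := n.cast_nonneg
        simp
        linarith
      · rcases Nat.eq_zero_or_pos n with rfl | hn0
        · obtain ⟨c₂, h⟩ := hasPrincipalPart_logKernel_zero hy
          exact ⟨c₂, _, by simpa using h⟩
        · have := hasPrincipalPart_logKernel_int hy (n := n) (by omega)
          exact ⟨_, _, by exact_mod_cast this⟩)
  rw [key, Finset.sum_image (fun a _ b _ h => by simpa using h)]
  congr 2
  refine Finset.sum_congr rfl fun n _ => ?_
  have h1 := hρint (-1 - n)
  push_cast at h1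
  rw [h1]
  have e1 : ((-1 : ℂ) ^ (-1 - (n : ℤ))) = -(-1) ^ n := by
    rw [zpow_sub₀ (by norm_num), zpow_natCast]
    have : ((-1 : ℂ) ^ n) * (-1) ^ n = 1 := by rw [← mul_pow]; simp
    have h0 : ((-1 : ℂ) ^ n) ≠ 0 := pow_ne_zero _ (by norm_num)
    field_simp
    rw [sq, this]
  have e2 : (y : ℂ) ^ (-(-1 - (n : ℂ))) = (y : ℂ) ^ (n + 1) := by
    rw [← Complex.cpow_natCast]; congr 1; push_cast; ring
  have h0 : (n : ℂ) + 1 ≠ 0 := Nat.cast_add_one_ne_zero n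
  rw [e1, e2, show (-1 - n : ℂ) = -(n + 1) by ring]
  field_simp

lemma separatesIntegers_verticalLine : (verticalLine (-1 / 2)).SeparatesIntegers := by
  refine ⟨fun n => mem_leftSide_of_re_lt fun u => ?_, fun n => mem_rightSide_of_lt_re fun u => ?_⟩
  all_goals
    have : (0 : ℝ) ≤ n := n.cast_nonneg
    rw [verticalLine_path_re]
    simp
    linarith

/-- On the line `Re s = -N - 1/2` the power has modulus at most `yᴺ`, so the line integral tends to
zero while the residues sum to the logarithmic series. -/
lemma SeparatesIntegers.integral_logKernel_of_lt_one (hL : L.SeparatesIntegers) {y : ℝ}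
    (hy : 0 < y) (hy1 : y < 1) : L.integral (fun s => logKernel s * (y : ℂ) ^ (-s)) =
      2 * Real.pi * Complex.I * Real.log (1 + y) := by
  have hline : Tendsto (fun N : ℕ => (verticalLine (-N - 1 / 2)).integral
      (fun s => logKernel s * (y : ℂ) ^ (-s))) atTop (𝓝 0) := by
    have hb : Tendsto (fun N : ℕ => (6 * Real.pi * ∫ u : ℝ, Real.exp (-|u|)) * y ^ N) atTop
        (𝓝 0) := by
      simpa using (tendsto_pow_atTop_nhds_zero_of_lt_one hy.le hy1).const_mul
        (6 * Real.pi * ∫ u : ℝ, Real.exp (-|u|))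
    refine squeeze_zero_norm (fun N => ?_) hb
    rw [integral_verticalLine]
    have := norm_integral_le_of_norm_le
      (integrable_exp_neg_abs.const_mul (6 * Real.pi * y ^ N)) (f := fun u : ℝ =>
        logKernel (((-N - 1 / 2 : ℝ) : ℂ) + u * Complex.I) *
          (y : ℂ) ^ (-(((-N - 1 / 2 : ℝ) : ℂ) + u * Complex.I)) * Complex.I)
      (Eventually.of_forall fun u => by
        rw [norm_mul, norm_mul, Complex.norm_I, mul_one, norm_ofReal_cpow_neg hy]
        have h1 := norm_logKernel_half_integer_line_le N u
        have h2 : y ^ (-(((-N - 1 / 2 : ℝ) : ℂ) + u * Complex.I).re) ≤ y ^ N := by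
          rw [← Real.rpow_natCast]
          refine Real.rpow_le_rpow_of_exponent_ge hy hy1.le ?_
          simp
        calc _ ≤ (6 * Real.pi * Real.exp (-|u|)) * y ^ N :=
              mul_le_mul h1 h2 (Real.rpow_nonneg hy.le _) (by positivity)
          _ = _ := by ring)
    rw [integral_const_mul] at this
    refine this.trans_eq ?_
    ring
  have hsum : Tendsto (fun N : ℕ => ∑ n ∈ Finset.range N, (-1) ^ n * (y : ℂ) ^ (n + 1) / (n + 1))
      atTop (𝓝 (Real.log (1 + y) : ℂ)) := by
    have h := (Real.hasSum_pow_div_log_of_abs_lt_one (x := -y)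
      (by rw [abs_neg, abs_of_pos hy]; exact hy1)).neg.tendsto_sum_nat
    rw [neg_neg, sub_neg_eq_add] at h
    have h' := (Complex.continuous_ofReal.tendsto _).comp h
    refine h'.congr fun N => ?_
    simp only [Function.comp_apply, Complex.ofReal_sum]
    refine Finset.sum_congr rfl fun n _ => ?_
    push_cast
    rw [neg_pow (y : ℂ) (n + 1), pow_succ (-1 : ℂ)]
    ring
  have := hline.add (hsum.const_mul (2 * Real.pi * Complex.I : ℂ))
  rw [zero_add] at this
  refine tendsto_nhds_unique (tendsto_const_nhds.congr' ?_) this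
  filter_upwards [hL.eventually_integral_logKernel hy] with N hN using hN

/-- Moving the line from `1/2` to `-1/2` crosses only the double pole at `0`. The kernel is even, so
`s ↦ -s` carries the line at `1/2` back to `-1/2` and replaces `y` by `y⁻¹`. -/
lemma integral_logKernel_eq_integral_inv {y : ℝ} (hy : 0 < y) :
    (verticalLine (-1 / 2)).integral (fun s => logKernel s * (y : ℂ) ^ (-s)) =
      (verticalLine (-1 / 2)).integral (fun s => logKernel s * ((y⁻¹ : ℝ) : ℂ) ^ (-s)) +
        2 * Real.pi * Complex.I * Real.log y := by
  classical
  have key := integral_sub_verticalLine (L := verticalLine (1 / 2)) (a := -1) (b := 1)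
    (c := -1 / 2) (Pl := {0}) (Pr := ∅) (F := fun s => logKernel s * (y : ℂ) ^ (-s))
    (ρ := fun _ => -Real.log y)
    (fun u => by simp only [reStrip, mem_ofPred_eq, verticalLine_path_re]; norm_num)
    (by norm_num)
    (fun s hs => by
      apply DifferentiableAt.differentiableWithinAt
      apply differentiableAt_logKernel_mul_cpow hy
      rintro n rfl
      obtain ⟨⟨h1, h2⟩, h3⟩ := hs
      simp only [Complex.intCast_re] at h1 h2
      have h1' : -1 < n := by exact_mod_cast h1
      have h2' : n < 1 := by exact_mod_cast h2
      obtain rfl : n = 0 := by omega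
      simp at h3)
    (verticalExpDecay_logKernel.mul_cpow hy)
    (fun p hp => by
      obtain rfl := Finset.mem_singleton.1 hp
      refine ⟨mem_leftSide_of_re_lt fun u => by rw [verticalLine_path_re]; norm_num, by norm_num,
        hasPrincipalPart_logKernel_zero hy⟩)
    (fun p hp => by simp at hp)
  have hsym : (verticalLine (1 / 2)).integral (fun s => logKernel s * (y : ℂ) ^ (-s)) =
      (verticalLine (-1 / 2)).integral (fun s => logKernel s * ((y⁻¹ : ℝ) : ℂ) ^ (-s)) := by
    rw [integral_verticalLine, integral_verticalLine, ← integral_neg_eq_self]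
    refine integral_congr_ae (Eventually.of_forall fun u => ?_)
    have e : (((1 / 2 : ℝ) : ℂ) + ((-u : ℝ) : ℂ) * Complex.I) =
        -(((-1 / 2 : ℝ) : ℂ) + (u : ℂ) * Complex.I) := by push_cast; ring
    simp only [e]
    generalize ((-1 / 2 : ℝ) : ℂ) + (u : ℂ) * Complex.I = s
    rw [logKernel, logKernel, mul_neg, Complex.sin_neg, neg_mul_neg, neg_neg, Complex.ofReal_inv,
      Complex.cpow_neg, Complex.inv_cpow, inv_inv]
    rw [Complex.arg_ofReal_of_nonneg hy.le]
    exact Real.pi_pos.ne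
  rw [hsym] at key
  rw [key]
  simp

/-- The Mellin–Barnes representation of `log (1 + y)`. -/
theorem SeparatesIntegers.integral_logKernel (hL : L.SeparatesIntegers) {y : ℝ}
    (hy : 0 < y) (hy1 : y ≠ 1) : L.integral (fun s => logKernel s * (y : ℂ) ^ (-s)) =
      2 * Real.pi * Complex.I * Real.log (1 + y) := by
  rcases lt_or_gt_of_ne hy1 with h | h
  · exact hL.integral_logKernel_of_lt_one hy h
  · have hS := separatesIntegers_verticalLine
    -- Both contours shift to the same line with the same residues, so `L` may be replaced by the
    -- line at `-1/2`, where inversion reduces to `y⁻¹ < 1` and `log(1 + y⁻¹) + log y = log(1 + y)`.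
    obtain ⟨N, h1, h2⟩ :=
      ((hL.eventually_integral_logKernel hy).and (hS.eventually_integral_logKernel hy)).exists
    rw [h1, ← h2, integral_logKernel_eq_integral_inv hy,
      hS.integral_logKernel_of_lt_one (inv_pos.2 hy) (inv_lt_one_of_one_lt₀ h), ← mul_add,
      ← Complex.ofReal_add, ← Real.log_mul (by positivity) (by positivity)]
    congr 3
    field_simp
    ring

end MBContour

/-! ### Bounds for the gamma function on vertical strips -/

namespace Complex

lemma norm_sin_le_exp_abs_im (z : ℂ) : ‖sin z‖ ≤ Real.exp |z.im| := by
  have e : sin z = (exp (-z * I) - exp (z * I)) * (I / 2) := by rw [sin]; ring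
  have n1 : ‖exp (-z * I)‖ ≤ Real.exp |z.im| := by
    simpa [norm_exp] using le_abs_self z.im
  have n2 : ‖exp (z * I)‖ ≤ Real.exp |z.im| := by
    simpa [norm_exp] using neg_le_abs z.im
  rw [e, norm_mul, norm_div, norm_I, norm_ofNat]
  linarith [norm_sub_le (exp (-z * I)) (exp (z * I))]

/-- On this line `1 - z` is the conjugate of `z`, so reflection gives `|Γ(z)|² = π / |sin πz|`. -/
lemma norm_Gamma_one_half_add_le {τ : ℝ} (h : 1 ≤ |τ|) :
    ‖Gamma (1 / 2 + τ * I)‖ ≤ 2 * Real.pi * Real.exp (-(Real.pi / 2 * |τ|)) := by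
  set z : ℂ := 1 / 2 + τ * I with hz
  have hconj : (starRingEnd ℂ) z = 1 - z := by
    apply Complex.ext <;> simp [hz]
    norm_num
  have hn : ‖Gamma (1 - z)‖ = ‖Gamma z‖ := by rw [← hconj, Gamma_conj, norm_conj]
  have href := congrArg norm (Gamma_mul_Gamma_one_sub z)
  rw [norm_mul, hn, norm_div, norm_real, Real.norm_of_nonneg Real.pi_pos.le] at href
  have him : |(Real.pi * z : ℂ).im| = Real.pi * |τ| := by
    simp [hz, abs_mul, abs_of_pos Real.pi_pos]
  have hpi := Real.pi_gt_three
  have hsin : Real.exp (Real.pi * |τ|) / 4 ≤ ‖sin (Real.pi * z)‖ := by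
    refine le_trans ?_ (sinh_abs_im_le_norm_sin _)
    rw [him]
    exact exp_div_four_le_sinh (by nlinarith)
  have hsq : ‖Gamma z‖ ^ 2 ≤ (2 * Real.pi * Real.exp (-(Real.pi / 2 * |τ|))) ^ 2 := by
    rw [sq, href]
    calc Real.pi / ‖sin (Real.pi * z)‖ ≤ Real.pi / (Real.exp (Real.pi * |τ|) / 4) := by gcongr
      _ = 4 * Real.pi * Real.exp (-(Real.pi * |τ|)) := by rw [Real.exp_neg]; field_simp
      _ ≤ 4 * Real.pi ^ 2 * Real.exp (-(Real.pi * |τ|)) := by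
        gcongr
        nlinarith
      _ = _ := by
        rw [mul_pow, mul_pow, ← Real.exp_nat_mul]
        congr 2
        · norm_num
        · push_cast; ring
  exact le_of_sq_le_sq hsq (by positivity)

/-- `Γ` is bounded by a polynomial times `exp (-π |Im s| / 2)` on the strip `a ≤ Re s ≤ b`. -/
def GammaStripBound (a b : ℝ) : Prop :=
  ∃ (C : ℝ) (N : ℕ), 0 ≤ C ∧ ∀ s : ℂ, a ≤ s.re → s.re ≤ b → 1 ≤ |s.im| →
    ‖Gamma s‖ ≤ C * (1 + |s.im|) ^ N * Real.exp (-(Real.pi / 2 * |s.im|))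

lemma ne_zero_of_one_le_abs_im {s : ℂ} (h : 1 ≤ |s.im|) : s ≠ 0 := by
  rintro rfl
  norm_num at h

lemma norm_Gamma_add_nat_half_le (n : ℕ) : ∃ C : ℝ, 0 ≤ C ∧ ∀ τ : ℝ, 1 ≤ |τ| →
    ‖Gamma (n + 1 / 2 + τ * I)‖ ≤ C * (1 + |τ|) ^ n * Real.exp (-(Real.pi / 2 * |τ|)) := by
  induction n with
  | zero =>
    refine ⟨2 * Real.pi, by positivity, fun τ h => ?_⟩
    simpa using norm_Gamma_one_half_add_le h
  | succ n ih =>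
    obtain ⟨C, hC, h⟩ := ih
    refine ⟨C * (n + 1), by positivity, fun τ hτ => ?_⟩
    set s : ℂ := n + 1 / 2 + τ * I with hs
    have hs0 : s ≠ 0 := ne_zero_of_one_le_abs_im (by simpa [hs] using hτ)
    have e : ((n + 1 : ℕ) : ℂ) + 1 / 2 + τ * I = s + 1 := by rw [hs]; push_cast; ring
    have hns : ‖s‖ ≤ (n + 1) * (1 + |τ|) := by
      calc ‖s‖ ≤ |s.re| + |s.im| := norm_le_abs_re_add_abs_im s
        _ = (n + 1 / 2) + |τ| := by
          have hr : s.re = n + 1 / 2 := by simp [hs]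
          have hi : s.im = τ := by simp [hs]
          rw [hr, hi, abs_of_nonneg (by positivity)]
        _ ≤ _ := by nlinarith [abs_nonneg τ, (n.cast_nonneg : (0 : ℝ) ≤ n)]
    rw [e, Gamma_add_one _ hs0, norm_mul]
    calc _ ≤ ((n + 1) * (1 + |τ|)) * (C * (1 + |τ|) ^ n * Real.exp (-(Real.pi / 2 * |τ|))) :=
          mul_le_mul hns (h τ hτ) (norm_nonneg _) (by positivity)
      _ = _ := by ring

lemma norm_betaIntegral_le_one {s t : ℂ} (hs : 1 ≤ s.re) (ht : 1 ≤ t.re) :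
    ‖betaIntegral s t‖ ≤ 1 := by
  rw [betaIntegral]
  have := intervalIntegral.norm_integral_le_of_norm_le_const (a := 0) (b := 1) (C := 1)
    (f := fun x : ℝ => (x : ℂ) ^ (s - 1) * (1 - (x : ℂ)) ^ (t - 1)) (fun x hx => by
      rw [uIoc_of_le zero_le_one] at hx
      rcases hx.2.lt_or_eq with h | rfl
      · have h1 : 0 < 1 - x := by linarith
        rw [norm_mul, norm_cpow_eq_rpow_re_of_pos hx.1, ← ofReal_one, ← ofReal_sub,
          norm_cpow_eq_rpow_re_of_pos h1]
        refine mul_le_one₀ (Real.rpow_le_one hx.1.le hx.2 ?_) (Real.rpow_nonneg h1.le _)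
          (Real.rpow_le_one h1.le (by linarith [hx.1]) ?_) <;> simpa
      · rw [norm_mul, ofReal_one, one_cpow, norm_one, one_mul, sub_self]
        by_cases h : t - 1 = 0
        · rw [h, cpow_zero, norm_one]
        · rw [zero_cpow h, norm_zero]; exact zero_le_one)
  simpa using this

/-- A real `w = 7/2 - Re s` moves `s + w` to the line `Re = 3 + 1/2`, where `Γ` is already bounded.
In `Γ(s) Γ(w) = Γ(s + w) B(s, w)` the beta factor is at most `1`, and `Γ(w)` has a positive minimum
on `[3/2, 5/2]`. -/
lemma gammaStripBound_one_two : GammaStripBound 1 2 := by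
  obtain ⟨C, hC, h⟩ := norm_Gamma_add_nat_half_le 3
  have hcont : ContinuousOn Real.Gamma (Icc (3 / 2) (5 / 2)) := fun x hx =>
    (Real.differentiableAt_Gamma fun m => by
      have : (0 : ℝ) ≤ m := m.cast_nonneg
      linarith [hx.1]).continuousAt.continuousWithinAt
  obtain ⟨x₀, hx₀, hmin⟩ := isCompact_Icc.exists_isMinOn ⟨2, by norm_num⟩ hcont
  have hc : 0 < Real.Gamma x₀ := Real.Gamma_pos_of_pos (by linarith [hx₀.1])
  refine ⟨C / Real.Gamma x₀, 3, by positivity, fun s h1 h2 h3 => ?_⟩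
  set w : ℝ := 7 / 2 - s.re with hw
  have hwm : w ∈ Icc (3 / 2 : ℝ) (5 / 2) := by constructor <;> linarith
  have hβ := congrArg norm (Gamma_mul_Gamma_eq_betaIntegral (s := s) (t := w) (by linarith)
    (by rw [ofReal_re]; linarith [hwm.1]))
  have hsum : s + w = ((3 : ℕ) : ℂ) + 1 / 2 + s.im * I := by
    apply Complex.ext <;> simp [hw]
    norm_num
  rw [norm_mul, norm_mul, hsum, Gamma_ofReal, norm_real,
    Real.norm_of_nonneg (Real.Gamma_pos_of_pos (by linarith [hwm.1])).le] at hβ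
  have hb := norm_betaIntegral_le_one (s := s) (t := w) h1 (by rw [ofReal_re]; linarith [hwm.1])
  have h4 := h s.im h3
  have h5 : ‖Gamma s‖ * Real.Gamma x₀ ≤
      C * (1 + |s.im|) ^ 3 * Real.exp (-(Real.pi / 2 * |s.im|)) :=
    calc ‖Gamma s‖ * Real.Gamma x₀ ≤ ‖Gamma s‖ * Real.Gamma w := by
          gcongr
          exact hmin hwm
      _ ≤ _ * 1 := by
          rw [hβ]
          gcongr
      _ ≤ _ := by rw [mul_one]; exact h4
  rw [← le_div_iff₀ hc] at h5
  refine h5.trans_eq ?_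
  ring

/-- The recurrence `Γ(s + 1) = s Γ(s)` widens the strip by one on each side: on the left by division
by `|s| ≥ 1`, on the right at the cost of one power of `1 + |Im s|`. -/
lemma gammaStripBound_nat (M : ℕ) : GammaStripBound (1 - M) (2 + M) := by
  induction M with
  | zero => simpa using gammaStripBound_one_two
  | succ M ih =>
    obtain ⟨C, N, hC, h⟩ := ih
    refine ⟨C * (3 + M), N + 1, by positivity, fun s h1 h2 h3 => ?_⟩
    push_cast at h1 h2
    have hM : (0 : ℝ) ≤ M := M.cast_nonneg
    have hmono : C * (1 + |s.im|) ^ N * Real.exp (-(Real.pi / 2 * |s.im|)) ≤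
        C * (3 + M) * (1 + |s.im|) ^ (N + 1) * Real.exp (-(Real.pi / 2 * |s.im|)) := by
      gcongr
      · nlinarith
      · linarith
      · omega
    rcases lt_or_ge s.re (1 - M) with hlt | hge
    · refine le_trans ?_ hmono
      have hs0 := ne_zero_of_one_le_abs_im h3
      have h4 := h (s + 1) (by simp; linarith) (by simp; linarith) (by simpa using h3)
      rw [Gamma_add_one _ hs0, norm_mul] at h4
      have hs1 : 1 ≤ ‖s‖ := h3.trans (abs_im_le_norm s)
      simp only [add_im, one_im, add_zero] at h4
      nlinarith [norm_nonneg (Gamma s)]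
    rcases le_or_gt s.re (2 + M) with hle | hgt
    · exact (h s hge hle h3).trans hmono
    · have h3' : 1 ≤ |(s - 1).im| := by simpa using h3
      have hs0 := ne_zero_of_one_le_abs_im h3'
      have h4 := h (s - 1) (by simp; linarith) (by simp; linarith) h3'
      simp only [sub_im, one_im, sub_zero] at h4
      have e : Gamma s = (s - 1) * Gamma (s - 1) := by
        rw [← Gamma_add_one _ hs0, sub_add_cancel]
      have hn : ‖s - 1‖ ≤ (3 + M) * (1 + |s.im|) := by
        calc ‖s - 1‖ ≤ |(s - 1).re| + |(s - 1).im| := norm_le_abs_re_add_abs_im _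
          _ ≤ (2 + M) + |s.im| := by
            simp only [sub_re, one_re, sub_im, one_im, sub_zero]
            rw [abs_of_nonneg (by linarith)]
            linarith
          _ ≤ _ := by nlinarith
      rw [e, norm_mul]
      calc _ ≤ ((3 + M) * (1 + |s.im|)) *
            (C * (1 + |s.im|) ^ N * Real.exp (-(Real.pi / 2 * |s.im|))) :=
            mul_le_mul hn h4 (norm_nonneg _) (by positivity)
        _ = _ := by ring

theorem gammaStripBound (a b : ℝ) : GammaStripBound a b := by
  obtain ⟨M, hM⟩ := exists_nat_ge (max (1 - a) b)
  obtain ⟨C, N, hC, h⟩ := gammaStripBound_nat M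
  exact ⟨C, N, hC, fun s h1 h2 h3 => h s (by linarith [le_max_left (1 - a) b])
    (by linarith [le_max_right (1 - a) b]) h3⟩

end Complex

/-! ### Decay and residues of the Kummer kernel -/

lemma one_add_pow_le_exp_half (N : ℕ) {x : ℝ} (hx : 0 ≤ x) :
    (1 + x) ^ N ≤ 2 ^ N * N.factorial * Real.exp 1 * Real.exp (x / 2) := by
  have h := Real.pow_div_factorial_le_exp ((1 + x) / 2) (by positivity) N
  rw [div_pow, div_div, div_le_iff₀ (by positivity)] at h
  have h2 : Real.exp ((1 + x) / 2) ≤ Real.exp 1 * Real.exp (x / 2) := by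
    rw [← Real.exp_add]
    exact Real.exp_le_exp.2 (by linarith)
  calc _ ≤ _ := h
    _ ≤ (Real.exp 1 * Real.exp (x / 2)) * (2 ^ N * N.factorial) := by gcongr
    _ = _ := by ring

/-- The kernel `Γ(t) Γ(1 - m - t) / Γ(1 - t)`, whose inverse Mellin transform is a confluent
hypergeometric function. -/
def kummerKernel (m : ℝ) (t : ℂ) : ℂ :=
  Complex.Gamma t * Complex.Gamma (1 - m - t) * (Complex.Gamma (1 - t))⁻¹

/-- Reflection trades `1/Γ(1 - t)` for `Γ(t) sin(πt)/π`, so upper bounds for `Γ` suffice. -/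
lemma kummerKernel_eq_of_im_ne_zero (m : ℝ) {t : ℂ} (ht : t.im ≠ 0) :
    kummerKernel m t = Complex.Gamma t * Complex.Gamma t * Complex.Gamma (1 - m - t)
      * Complex.sin (Real.pi * t) / Real.pi := by
  have hint : ∀ n : ℕ, 1 - t ≠ -n := fun n h => ht (by
    have := congrArg Complex.im h
    simpa using this)
  have hG := Complex.Gamma_ne_zero hint
  have hs : Complex.sin (Real.pi * t) ≠ 0 := sin_pi_mul_ne_zero (x := t) fun ⟨n, hn⟩ => ht (by
    rw [← hn]; simp)
  have hpi : (Real.pi : ℂ) ≠ 0 := Complex.ofReal_ne_zero.2 Real.pi_ne_zero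
  have href := Complex.Gamma_mul_Gamma_one_sub t
  rw [eq_div_iff hs] at href
  rw [kummerKernel]
  generalize Complex.sin (Real.pi * t) = S at href ⊢
  field_simp
  linear_combination (-Complex.Gamma t * Complex.Gamma (1 - m - t)) * href

/-- With `x = |Im s|`, three gamma factors give `exp(-3πx/2)` and the sine `exp(πx)`. The remaining
`exp(-πx/2)` beats `exp(-x)` with `exp(x/2)` to spare for the polynomial, since `π > 3`. -/
lemma verticalExpDecay_kummerKernel (m : ℝ) : VerticalExpDecay (kummerKernel m) := by
  intro a b
  obtain ⟨C₁, N₁, hC₁, h₁⟩ := Complex.gammaStripBound a b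
  obtain ⟨C₂, N₂, hC₂, h₂⟩ := Complex.gammaStripBound (1 - m - b) (1 - m - a)
  set K : ℝ := 2 ^ (N₁ + N₁ + N₂) * (N₁ + N₁ + N₂).factorial * Real.exp 1 with hK
  refine ⟨C₁ * C₁ * C₂ * K, fun s hsa hsb him => ?_⟩
  have i0 : s.im ≠ 0 := fun h => by rw [h] at him; norm_num at him
  have b1 := h₁ s hsa hsb him
  have b2 := h₂ (1 - m - s) (by simp; linarith) (by simp; linarith) (by simpa using him)
  have e2 : |(1 - m - s : ℂ).im| = |s.im| := by simp
  rw [e2] at b2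
  have b3 : ‖Complex.sin (Real.pi * s)‖ ≤ Real.exp (Real.pi * |s.im|) := by
    have := Complex.norm_sin_le_exp_abs_im (Real.pi * s)
    simpa [abs_mul, abs_of_pos Real.pi_pos] using this
  set x := |s.im| with hx
  have hx0 : 0 ≤ x := abs_nonneg _
  set E := Real.exp (-(Real.pi / 2 * x)) with hE
  have hexp : E * E * E * Real.exp (Real.pi * x) = E := by
    have : E * E * Real.exp (Real.pi * x) = 1 := by
      rw [hE, ← Real.exp_add, ← Real.exp_add, Real.exp_eq_one_iff]; ring
    linear_combination E * this
  have hfin : (1 + x) ^ (N₁ + N₁ + N₂) * E ≤ K * Real.exp (-x) := by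
    have h1 := one_add_pow_le_exp_half (N₁ + N₁ + N₂) hx0
    have h2 : Real.exp (x / 2) * E ≤ Real.exp (-x) := by
      rw [hE, ← Real.exp_add, Real.exp_le_exp]
      nlinarith [Real.pi_gt_three]
    calc _ ≤ (K * Real.exp (x / 2)) * E := by gcongr
      _ = K * (Real.exp (x / 2) * E) := by ring
      _ ≤ _ := by gcongr
  rw [kummerKernel_eq_of_im_ne_zero m i0, norm_div, norm_mul, norm_mul, norm_mul,
    Complex.norm_real, Real.norm_of_nonneg Real.pi_pos.le]
  calc _ ≤ ‖Complex.Gamma s‖ * ‖Complex.Gamma s‖ * ‖Complex.Gamma (1 - m - s)‖ *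
        ‖Complex.sin (Real.pi * s)‖ :=
        div_le_self (by positivity) (by linarith [Real.pi_gt_three])
    _ ≤ (C₁ * (1 + x) ^ N₁ * E) * (C₁ * (1 + x) ^ N₁ * E) * (C₂ * (1 + x) ^ N₂ * E) *
        Real.exp (Real.pi * x) := by gcongr
    _ = C₁ * C₁ * C₂ * ((1 + x) ^ (N₁ + N₁ + N₂) * (E * E * E * Real.exp (Real.pi * x))) := by
        rw [pow_add, pow_add]; ring
    _ ≤ C₁ * C₁ * C₂ * (K * Real.exp (-x)) := by
        rw [hexp]; gcongr
    _ = _ := by ring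

lemma analyticAt_inv_Gamma (p : ℂ) : AnalyticAt ℂ (fun s => (Complex.Gamma s)⁻¹) p :=
  Complex.differentiable_one_div_Gamma.analyticAt p

lemma analyticAt_Gamma {p : ℂ} (hp : ∀ n : ℕ, p ≠ -n) : AnalyticAt ℂ Complex.Gamma p := by
  have := (analyticAt_inv_Gamma p).inv (inv_ne_zero (Complex.Gamma_ne_zero hp))
  simpa [Pi.inv_def] using this

/-- `Γ` has a simple pole at `-n` with residue `(-1)ⁿ / n!`. -/
lemma exists_Gamma_eq_div (n : ℕ) : ∃ G : ℂ → ℂ, AnalyticAt ℂ G (-n) ∧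
    G (-n) = (-1) ^ n / n.factorial ∧
    ∀ᶠ s in 𝓝[≠] (-n : ℂ), Complex.Gamma s = G s / (s + n) := by
  have hD := dslope_sin_pi_mul_self_ne_zero (-n)
  have hA := analyticAt_dslope_sin_pi_mul (-n)
  have hV := dslope_sin_pi_mul_self (-n)
  have hE := sin_pi_mul_eq_sub_mul_dslope (-n)
  push_cast at hD hA hV hE
  set S := dslope (fun s : ℂ => Complex.sin (Real.pi * s)) (-n) with hS
  have hpi : (Real.pi : ℂ) ≠ 0 := Complex.ofReal_ne_zero.2 Real.pi_ne_zero
  -- From reflection, `Γ(s) = π / (sin(πs) Γ(1 - s))`, with the zero of the sine at `-n` split off.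
  refine ⟨fun s => Real.pi / S s * (Complex.Gamma (1 - s))⁻¹, ?_, ?_, ?_⟩
  · refine (analyticAt_const.div hA hD).mul ?_
    exact ((Complex.differentiable_one_div_Gamma).comp
      (differentiable_id.const_sub (1 : ℂ))).analyticAt _
  · simp only [hV, sub_neg_eq_add]
    rw [add_comm (1 : ℂ), Complex.Gamma_nat_eq_factorial]
    have h2 : ((-1 : ℂ) ^ n) ≠ 0 := pow_ne_zero _ (by norm_num)
    have h1 : ((-1 : ℂ) ^ n) * (-1) ^ n = 1 := by rw [← mul_pow]; simp
    have h3 : (n.factorial : ℂ) ≠ 0 := by exact_mod_cast n.factorial_ne_zero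
    rw [zpow_neg, zpow_natCast]
    field_simp
  · have hre : ∀ᶠ s : ℂ in 𝓝[≠] (-n : ℂ), s.re < 1 := by
      refine (Complex.continuous_re.continuousAt.eventually (gt_mem_nhds ?_)).filter_mono
        nhdsWithin_le_nhds
      have : (0 : ℝ) ≤ n := n.cast_nonneg
      simp
      linarith
    filter_upwards [hre] with s hs
    have hG : Complex.Gamma (1 - s) ≠ 0 :=
      Complex.Gamma_ne_zero_of_re_pos (by simpa using hs)
    have href := Complex.Gamma_mul_Gamma_one_sub s
    rw [hE, sub_neg_eq_add] at href
    rw [eq_div_of_mul_eq hG href, div_eq_mul_inv (Real.pi : ℂ), mul_inv]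
    ring

lemma differentiableAt_kummerKernel_mul_cpow {m y : ℝ} (hy : 0 < y) {t : ℂ}
    (h1 : ∀ n : ℕ, t ≠ -n) (h2 : ∀ n : ℕ, t ≠ 1 - m + n) :
    DifferentiableAt ℂ (fun t => kummerKernel m t * (y : ℂ) ^ (-t)) t := by
  have hy' : (y : ℂ) ≠ 0 := Complex.ofReal_ne_zero.2 hy.ne'
  have d1 := Complex.differentiableAt_Gamma t h1
  have d2 : DifferentiableAt ℂ (fun t : ℂ => Complex.Gamma (1 - m - t)) t :=
    (Complex.differentiableAt_Gamma (1 - m - t) fun n h => h2 n (by linear_combination -h)).comp t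
      (differentiableAt_id.const_sub _)
  have d3 : DifferentiableAt ℂ (fun t : ℂ => (Complex.Gamma (1 - t))⁻¹) t :=
    (Complex.differentiable_one_div_Gamma.comp (differentiable_id.const_sub (1 : ℂ))) t
  exact ((d1.mul d2).mul d3).mul (differentiableAt_id.neg.const_cpow (Or.inl hy'))

/-- As `m` is not an integer, `Γ(1 - m - t)` is analytic at `-n` and the pole of `Γ(t)` stays
simple. -/
lemma hasPrincipalPart_kummerKernel_neg_nat {m y : ℝ} (hm : ∀ n : ℤ, m ≠ n) (hy : 0 < y)
    (n : ℕ) : HasPrincipalPart (fun t => kummerKernel m t * (y : ℂ) ^ (-t)) (-n) 0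
      ((-1) ^ n / n.factorial * Complex.Gamma (1 - m + n) * (n.factorial : ℂ)⁻¹ * (y : ℂ) ^ n) := by
  obtain ⟨G, hG, hGv, hGe⟩ := exists_Gamma_eq_div n
  have hne : ∀ k : ℕ, (1 - m - -n : ℂ) ≠ -k := fun k h => hm (1 + n + k) (by
    have : (m : ℂ) = ((1 + n + k : ℝ) : ℂ) := by push_cast; linear_combination -h
    exact_mod_cast this)
  have a2 : AnalyticAt ℂ (fun t : ℂ => Complex.Gamma (1 - m - t)) (-n) :=
    (analyticAt_Gamma hne).comp (analyticAt_const.sub analyticAt_id)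
  have a3 : AnalyticAt ℂ (fun t : ℂ => (Complex.Gamma (1 - t))⁻¹) (-n) :=
    ((Complex.differentiable_one_div_Gamma).comp
      (differentiable_id.const_sub (1 : ℂ))).analyticAt _
  have h := hasPrincipalPart_of_eq_div (F := fun t => kummerKernel m t * (y : ℂ) ^ (-t))
    (((hG.mul a2).mul a3).mul (analyticAt_ofReal_cpow_neg hy (-n)))
    (by
      filter_upwards [hGe] with s hs
      simp only [kummerKernel, hs, Pi.mul_apply]
      ring)
  convert! h using 1
  simp only [Pi.mul_apply, hGv, neg_neg, sub_neg_eq_add, Complex.cpow_natCast]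
  rw [add_comm (1 : ℂ) n, Complex.Gamma_nat_eq_factorial]

/-- The coefficients are irrelevant: poles on the right of the contour have weight zero when it is
moved to the left. -/
lemma hasPrincipalPart_kummerKernel_right {m y : ℝ} (hm : ∀ n : ℤ, m ≠ n) (hy : 0 < y)
    (n : ℕ) : ∃ c₂ c₁, HasPrincipalPart (fun t => kummerKernel m t * (y : ℂ) ^ (-t))
      (1 - m + n) c₂ c₁ := by
  obtain ⟨G, hG, -, hGe⟩ := exists_Gamma_eq_div n
  have hne : ∀ k : ℕ, (1 - m + n : ℂ) ≠ -k := fun k h => hm (1 + n + k) (by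
    have : (m : ℂ) = ((1 + n + k : ℝ) : ℂ) := by push_cast; linear_combination -h
    exact_mod_cast this)
  have hval : (1 - m - (1 - m + n) : ℂ) = -n := by ring
  have hcont : Tendsto (fun t : ℂ => 1 - m - t) (𝓝[≠] (1 - m + n : ℂ)) (𝓝[≠] (-n : ℂ)) := by
    refine tendsto_nhdsWithin_iff.2 ⟨?_, ?_⟩
    · have : Continuous fun t : ℂ => (1 - m - t : ℂ) := by fun_prop
      have := (this.tendsto (1 - m + n)).mono_left
        (nhdsWithin_le_nhds (s := {(1 - m + n : ℂ)}ᶜ))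
      rwa [hval] at this
    · filter_upwards [self_mem_nhdsWithin] with t ht h
      exact ht (by
        have h' : (1 - m - t : ℂ) = -n := h
        change t = _
        linear_combination -h')
  have a1 := analyticAt_Gamma hne
  have a2 : AnalyticAt ℂ (fun t : ℂ => G (1 - m - t)) (1 - m + n) := by
    refine AnalyticAt.fun_comp (by rwa [hval]) (analyticAt_const.sub analyticAt_id)
  have a3 : AnalyticAt ℂ (fun t : ℂ => (Complex.Gamma (1 - t))⁻¹) (1 - m + n) :=
    ((Complex.differentiable_one_div_Gamma).comp
      (differentiable_id.const_sub (1 : ℂ))).analyticAt _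
  refine ⟨0, _, hasPrincipalPart_of_eq_div
    (((a1.mul a2.neg).mul a3).mul (analyticAt_ofReal_cpow_neg hy (1 - m + n))) ?_⟩
  filter_upwards [hcont.eventually hGe, self_mem_nhdsWithin] with t ht hne
  simp only [kummerKernel, ht, Pi.mul_apply, Pi.neg_apply]
  have h1 : (1 - m - t + n : ℂ) = -(t - (1 - m + n)) := by ring
  have h2 : t - (1 - m + n) ≠ 0 := sub_ne_zero.2 hne
  rw [h1]
  field_simp

/-! ### Shifting the Kummer integral to the far left -/

namespace MBContour

/-- The contour separates `0, -1, -2, …` on its left from `1 - m, 2 - m, …` on its right. -/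
def SeparatesKummer (m : ℝ) (L : MBContour) : Prop :=
  (∀ n : ℕ, -(n : ℂ) ∈ L.leftSide) ∧ ∀ n : ℕ, (1 - m + n : ℂ) ∈ L.rightSide

variable {L : MBContour} {m y : ℝ}

lemma SeparatesKummer.continuous_kummerKernel (hL : SeparatesKummer m L) (hy : 0 < y) :
    Continuous fun u => kummerKernel m (L.path u) * (y : ℂ) ^ (-L.path u) :=
  continuous_iff_continuousAt.2 fun u =>
    (differentiableAt_kummerKernel_mul_cpow hy
      (fun n h => not_mem_range_of_mem_leftSide (hL.1 n) ⟨u, h⟩)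
      (fun n h => not_mem_range_of_mem_rightSide (hL.2 n) ⟨u, h⟩)).continuousAt.comp
      (f := L.path) L.continuous_path.continuousAt

lemma SeparatesKummer.eventually_integral (hL : SeparatesKummer m L) (hm : ∀ n : ℤ, m ≠ n)
    (hy : 0 < y) : ∀ᶠ N : ℕ in atTop,
      L.integral (fun t => kummerKernel m t * (y : ℂ) ^ (-t)) =
        (verticalLine (-N - 1 / 2)).integral (fun t => kummerKernel m t * (y : ℂ) ^ (-t)) +
          2 * Real.pi * Complex.I * ∑ n ∈ Finset.range (N + 1),
            (-1) ^ n / n.factorial * Complex.Gamma (1 - m + n) * (n.factorial : ℂ)⁻¹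
              * (y : ℂ) ^ n := by
  classical
  obtain ⟨A, B, -, -, hAB⟩ := L.exists_re_bounds
  obtain ⟨K, hK⟩ := exists_nat_gt (B + m)
  -- The second bound puts even the smallest right-hand pole, `1 - m`, to the right of the line.
  filter_upwards [eventually_ge_atTop ⌈-A⌉₊, eventually_ge_atTop ⌈m⌉₊] with N hN hNm
  have hNA : -A ≤ N := Nat.ceil_le.1 hN
  have hNm' : m ≤ N := Nat.ceil_le.1 hNm
  have hAB0 : A ≤ B := (hAB 0).1.trans (hAB 0).2
  set ρ : ℂ → ℂ := fun p => Complex.cos (p * Real.pi) / Complex.Gamma (1 - p)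
    * Complex.Gamma (1 - m - p) * (Complex.Gamma (1 - p))⁻¹ * (y : ℂ) ^ (-p) with hρ
  have hρn : ∀ n : ℕ, ρ (-n) = (-1) ^ n / n.factorial * Complex.Gamma (1 - m + n)
      * (n.factorial : ℂ)⁻¹ * (y : ℂ) ^ n := fun n => by
    have := congrArg (fun x : ℝ => (x : ℂ)) (Real.cos_nat_mul_pi n)
    push_cast at this
    simp only [hρ]
    rw [neg_mul, Complex.cos_neg, this, sub_neg_eq_add, sub_neg_eq_add, neg_neg,
      Complex.cpow_natCast, add_comm (1 : ℂ) n, Complex.Gamma_nat_eq_factorial]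
  have key := integral_sub_verticalLine (L := L) (a := -N - 1) (b := B + 1) (c := -N - 1 / 2)
    (Pl := (Finset.range (N + 1)).image fun n : ℕ => -(n : ℂ))
    (Pr := (Finset.range (K + 1)).image fun n : ℕ => (1 - m + n : ℂ))
    (F := fun t => kummerKernel m t * (y : ℂ) ^ (-t)) (ρ := ρ)
    (fun u => ⟨by linarith [(hAB u).1], by linarith [(hAB u).2]⟩)
    ⟨by linarith, by linarith⟩
    (fun s hs => by
      apply DifferentiableAt.differentiableWithinAt
      obtain ⟨⟨h1, h2⟩, h3⟩ := hs
      simp only [Finset.coe_image, Finset.coe_range] at h3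
      refine differentiableAt_kummerKernel_mul_cpow hy (fun n hn => h3 (Or.inl ?_))
        (fun n hn => h3 (Or.inr ?_))
      · refine ⟨n, ?_, hn.symm⟩
        have e : s.re = -n := by rw [hn]; simp
        have : (n : ℝ) < N + 1 := by linarith
        exact_mod_cast this
      · refine ⟨n, ?_, hn.symm⟩
        have e : s.re = 1 - m + n := by rw [hn]; simp
        have : (n : ℝ) < K + 1 := by linarith
        exact_mod_cast this)
    ((verticalExpDecay_kummerKernel m).mul_cpow hy)
    (fun p hp => by
      obtain ⟨n, hn, rfl⟩ := Finset.mem_image.1 hp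
      refine ⟨hL.1 n, ?_, 0, ?_⟩
      · have : (n : ℝ) + 1 ≤ N + 1 := by exact_mod_cast Finset.mem_range.1 hn
        simp
        linarith
      · rw [hρn]
        exact hasPrincipalPart_kummerKernel_neg_nat hm hy n)
    (fun p hp => by
      obtain ⟨n, hn, rfl⟩ := Finset.mem_image.1 hp
      refine ⟨hL.2 n, ?_, hasPrincipalPart_kummerKernel_right hm hy n⟩
      have : (0 : ℝ) ≤ n := n.cast_nonneg
      simp
      linarith)
  rw [key, Finset.sum_image (fun a _ b _ h => by simpa using h)]
  congr 2
  exact Finset.sum_congr rfl fun n _ => hρn n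

/-- The functional equation of `Γ` gives the factor `-(1 - m - t)/(1 - t)²`, which is of order `1/|1
- t|`, with `|1 - t| ≥ j + 1`. -/
lemma _root_.norm_kummerKernel_sub_one_le (hm0 : 0 < m) {t : ℂ} {j : ℕ} (hj : t.re ≤ -j)
    (hmt : t.re < 1 - m) : ‖kummerKernel m (t - 1)‖ ≤ (1 + m) / (j + 1) * ‖kummerKernel m t‖ := by
  have hj0 : (0 : ℝ) ≤ j := j.cast_nonneg
  have ht1 : (1 - t : ℂ) ≠ 0 := fun h => by
    have := congrArg Complex.re h
    simp at this
    linarith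
  have ht1' : t - 1 ≠ 0 := fun h => ht1 (by linear_combination -h)
  have hm1 : (1 - m - t : ℂ) ≠ 0 := fun h => by
    have := congrArg Complex.re h
    simp at this
    linarith
  have g1 : Complex.Gamma t = (t - 1) * Complex.Gamma (t - 1) := by
    rw [← Complex.Gamma_add_one _ ht1', sub_add_cancel]
  have g2 : Complex.Gamma (1 - m - (t - 1)) = (1 - m - t) * Complex.Gamma (1 - m - t) := by
    rw [← Complex.Gamma_add_one _ hm1]; congr 1; ring
  have g3 : Complex.Gamma (1 - (t - 1)) = (1 - t) * Complex.Gamma (1 - t) := by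
    rw [← Complex.Gamma_add_one _ ht1]; congr 1; ring
  have e : kummerKernel m (t - 1) =
      -((1 - m - t) / (1 - t) ^ 2) * kummerKernel m t := by
    rw [kummerKernel, kummerKernel, g2, g3, g1, mul_inv]
    field_simp
    ring
  have hn : (j : ℝ) + 1 ≤ ‖1 - t‖ := by
    refine le_trans ?_ (Complex.re_le_norm _)
    simp
    linarith
  have hq : ‖(1 - m - t : ℂ)‖ ≤ (1 + m) * ‖1 - t‖ := by
    calc ‖(1 - m - t : ℂ)‖ = ‖(1 - t) - (m : ℂ)‖ := by congr 1; ring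
      _ ≤ ‖1 - t‖ + ‖(m : ℂ)‖ := norm_sub_le _ _
      _ = ‖1 - t‖ + m := by rw [Complex.norm_real, Real.norm_of_nonneg hm0.le]
      _ ≤ _ := by nlinarith
  rw [e, norm_mul, norm_neg, norm_div, norm_pow]
  refine mul_le_mul_of_nonneg_right ?_ (norm_nonneg _)
  have hpos : 0 < ‖1 - t‖ := by linarith
  calc ‖(1 - m - t : ℂ)‖ / ‖1 - t‖ ^ 2 ≤ (1 + m) * ‖1 - t‖ / ‖1 - t‖ ^ 2 := by gcongr
    _ = (1 + m) / ‖1 - t‖ := by field_simp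
    _ ≤ _ := by gcongr

lemma _root_.norm_kummerKernel_sub_nat_le (hm0 : 0 < m) {t : ℂ} (h0 : t.re ≤ 0)
    (hmt : t.re < 1 - m) (j : ℕ) :
    ‖kummerKernel m (t - j)‖ ≤ (1 + m) ^ j / j.factorial * ‖kummerKernel m t‖ := by
  induction j with
  | zero => simp
  | succ j ih =>
    have hj0 : (0 : ℝ) ≤ j := j.cast_nonneg
    have := norm_kummerKernel_sub_one_le hm0 (t := t - j) (j := j) (by simpa using h0)
      (by simp; linarith)
    rw [show t - ((j + 1 : ℕ) : ℂ) = t - j - 1 by push_cast; ring]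
    calc _ ≤ _ := this
      _ ≤ (1 + m) / (j + 1) * ((1 + m) ^ j / j.factorial * ‖kummerKernel m t‖) := by gcongr
      _ = _ := by
        rw [Nat.factorial_succ, pow_succ]; push_cast; field_simp

/-- Each unit step to the left multiplies the integrand by at most `(1 + m)y/(j + 1)`. Relative to a
fixed base line beyond `-m`, the integral is `O(((1 + m)y)ʲ/j!)`, for every `y`. -/
lemma tendsto_integral_kummerKernel_line (hm0 : 0 < m) (hy : 0 < y) :
    Tendsto (fun N : ℕ => (verticalLine (-N - 1 / 2)).integral
      (fun t => kummerKernel m t * (y : ℂ) ^ (-t))) atTop (𝓝 0) := by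
  obtain ⟨N₀, hN₀⟩ := exists_nat_ge m
  have hN₀0 : (0 : ℝ) ≤ N₀ := N₀.cast_nonneg
  rw [← tendsto_add_atTop_iff_nat N₀]
  set c : ℝ := -N₀ - 1 / 2 with hc
  have hint : Integrable fun u : ℝ =>
      kummerKernel m (c + u * Complex.I) * (y : ℂ) ^ (-(c + u * Complex.I : ℂ)) := by
    have hcont : Continuous fun u => kummerKernel m ((verticalLine c).path u) *
        (y : ℂ) ^ (-(verticalLine c).path u) := by
      refine continuous_iff_continuousAt.2 fun u =>
        (differentiableAt_kummerKernel_mul_cpow hy (fun n h => ?_) (fun n h => ?_)).continuousAt.comp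
          (f := (verticalLine c).path) (verticalLine c).continuous_path.continuousAt
      · have := congrArg Complex.re h
        rw [verticalLine_path_re] at this
        simp only [Complex.neg_re, Complex.natCast_re, hc] at this
        have h2 : ((2 * N₀ + 1 : ℕ) : ℝ) = ((2 * n : ℕ) : ℝ) := by push_cast; linarith
        have h3 : 2 * N₀ + 1 = 2 * n := by exact_mod_cast h2
        omega
      · have := congrArg Complex.re h
        rw [verticalLine_path_re] at this
        have hn : (0 : ℝ) ≤ n := n.cast_nonneg
        simp [hc] at this
        linarith
    have h := (verticalLine c).integrable_mul_deriv hcont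
      ((verticalExpDecay_kummerKernel m).mul_cpow hy)
    have hd : ∀ u, deriv (verticalLine c).path u = Complex.I := fun u => by
      have h : HasDerivAt (fun u : ℝ => (c : ℂ) + (u : ℂ) * Complex.I) Complex.I u := by
        simpa using ((hasDerivAt_id (u : ℂ)).comp_ofReal.mul_const Complex.I).const_add (c : ℂ)
      exact h.deriv
    simp_rw [hd] at h
    refine (h.mul_const (-Complex.I)).congr (Eventually.of_forall fun u => ?_)
    simp only [mul_neg, mul_assoc, Complex.I_mul_I]
    simp [verticalLine]
  set J := ∫ u : ℝ, ‖kummerKernel m (c + u * Complex.I) * (y : ℂ) ^ (-(c + u * Complex.I : ℂ))‖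
  have hb : Tendsto (fun j : ℕ => ((1 + m) * y) ^ j / j.factorial * J) atTop (𝓝 0) := by
    simpa using (FloorSemiring.tendsto_pow_div_factorial_atTop ((1 + m) * y)).mul_const J
  refine squeeze_zero_norm (fun j => ?_) hb
  rw [integral_verticalLine]
  have hpt : ∀ u : ℝ, ‖kummerKernel m (((-((j + N₀ : ℕ) : ℝ) - 1 / 2 : ℝ) : ℂ) + u * Complex.I) *
      (y : ℂ) ^ (-(((-((j + N₀ : ℕ) : ℝ) - 1 / 2 : ℝ) : ℂ) + u * Complex.I)) * Complex.I‖ ≤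
      ((1 + m) * y) ^ j / j.factorial *
        ‖kummerKernel m (c + u * Complex.I) * (y : ℂ) ^ (-(c + u * Complex.I : ℂ))‖ := by
    intro u
    set t : ℂ := c + u * Complex.I with ht
    have htr : t.re = c := by simp [ht]
    have e : (((-((j + N₀ : ℕ) : ℝ) - 1 / 2 : ℝ) : ℂ) + u * Complex.I) = t - j := by
      rw [ht, hc]; push_cast; ring
    have h1 := norm_kummerKernel_sub_nat_le hm0 (t := t) (by rw [htr]; linarith)
      (by rw [htr]; linarith) j
    have h2 : (y : ℂ) ^ (-(t - j)) = (y : ℂ) ^ (-t) * (y : ℂ) ^ j := by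
      rw [← Complex.cpow_natCast, ← Complex.cpow_add _ _ (Complex.ofReal_ne_zero.2 hy.ne')]
      congr 1; ring
    rw [e, h2, norm_mul, norm_mul, norm_mul, Complex.norm_I, mul_one, norm_mul, norm_pow,
      Complex.norm_real, Real.norm_of_nonneg hy.le]
    calc _ ≤ ((1 + m) ^ j / j.factorial * ‖kummerKernel m t‖) * (‖(y : ℂ) ^ (-t)‖ * y ^ j) := by
          gcongr
      _ = _ := by rw [mul_pow]; ring
  refine (norm_integral_le_of_norm_le (hint.norm.const_mul _)
    (Eventually.of_forall hpt)).trans_eq ?_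
  rw [integral_const_mul]

/-- The Mellin–Barnes representation of the confluent hypergeometric function, as a series. -/
theorem SeparatesKummer.tendsto_sum (hL : SeparatesKummer m L) (hm0 : 0 < m)
    (hm : ∀ n : ℤ, m ≠ n) (hy : 0 < y) :
    Tendsto (fun N : ℕ => 2 * Real.pi * Complex.I * ∑ n ∈ Finset.range N,
      (-1) ^ n / n.factorial * Complex.Gamma (1 - m + n) * (n.factorial : ℂ)⁻¹ * (y : ℂ) ^ n)
      atTop (𝓝 (L.integral (fun t => kummerKernel m t * (y : ℂ) ^ (-t)))) := by
  rw [← tendsto_add_atTop_iff_nat 1]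
  have h := (tendsto_integral_kummerKernel_line hm0 hy).const_sub
    (L.integral (fun t => kummerKernel m t * (y : ℂ) ^ (-t)))
  rw [sub_zero] at h
  refine h.congr' ?_
  filter_upwards [hL.eventually_integral hm hy] with N hN
  rw [hN]
  ring

end MBContour

/-! ### The confluent hypergeometric series and Kummer's transformation -/

lemma ascPochhammer_eval_one_real (n : ℕ) :
    (ascPochhammer ℝ n).eval 1 = (n.factorial : ℝ) := by
  simp

lemma kummer_one_eq (a z : ℝ) : kummer a 1 z =
    ∑' n : ℕ, (ascPochhammer ℝ n).eval a / (n.factorial : ℝ) * (z ^ n / (n.factorial : ℝ)) := by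
  simp only [kummer, ascPochhammer_eval_one_real]

lemma abs_ascPochhammer_eval_le (a : ℝ) (n : ℕ) :
    |(ascPochhammer ℝ n).eval a| ≤ (|a| + 1) ^ n * n.factorial := by
  induction n with
  | zero => simp
  | succ n ih =>
    have h : |a + n| ≤ (|a| + 1) * (n + 1) := by
      have hn : (0 : ℝ) ≤ n := n.cast_nonneg
      calc |a + n| ≤ |a| + |(n : ℝ)| := abs_add_le _ _
        _ = |a| + n := by rw [abs_of_nonneg hn]
        _ ≤ _ := by nlinarith [abs_nonneg a]
    rw [ascPochhammer_succ_eval, abs_mul, Nat.factorial_succ]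
    calc _ ≤ ((|a| + 1) ^ n * n.factorial) * ((|a| + 1) * (n + 1)) := by gcongr
      _ = _ := by push_cast; ring

lemma summable_kummer_terms (a z : ℝ) : Summable fun n : ℕ =>
    (ascPochhammer ℝ n).eval a / (n.factorial : ℝ) * (z ^ n / (n.factorial : ℝ)) := by
  refine Summable.of_norm_bounded (Real.summable_pow_div_factorial ((|a| + 1) * |z|))
    (fun n => ?_)
  have hf : (0 : ℝ) < n.factorial := by exact_mod_cast n.factorial_pos
  rw [Real.norm_eq_abs, abs_mul, abs_div, abs_div, abs_pow, abs_of_pos hf, mul_pow, mul_div_assoc]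
  gcongr
  rw [div_le_iff₀ hf]
  exact abs_ascPochhammer_eval_le a n

lemma hasSum_kummer_one (a z : ℝ) : HasSum (fun n : ℕ =>
    (ascPochhammer ℝ n).eval a / (n.factorial : ℝ) * (z ^ n / (n.factorial : ℝ)))
    (kummer a 1 z) := by
  rw [kummer_one_eq]
  exact (summable_kummer_terms a z).hasSum

/-- Binomial coefficients make the Chu–Vandermonde identity available for the Cauchy product. -/
lemma ascPochhammer_eval_div_factorial (a : ℝ) (n : ℕ) :
    (ascPochhammer ℝ n).eval a / (n.factorial : ℝ) = Ring.choose (a + n - 1) n := by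
  have hf : (n.factorial : ℝ) ≠ 0 := by exact_mod_cast n.factorial_ne_zero
  have h := Ring.factorial_nsmul_multichoose_eq_ascPochhammer a n
  rw [Polynomial.ascPochhammer_smeval_eq_eval, nsmul_eq_mul] at h
  rw [← h, mul_div_cancel_left₀ _ hf, Ring.multichoose_eq]

lemma ascPochhammer_one_sub_eval_div_factorial (m : ℝ) (n : ℕ) :
    (ascPochhammer ℝ n).eval (1 - m) / (n.factorial : ℝ) = (-1) ^ n * Ring.choose (m - 1) n := by
  have h := Ring.choose_neg (-(m - 1)) n
  have h1 : ((-1 : ℝ) ^ n) * (-1) ^ n = 1 := by rw [← mul_pow]; simp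
  rw [neg_neg, show -(m - 1) + (n : ℝ) - 1 = 1 - m + n - 1 by ring, Units.smul_def,
    zsmul_eq_mul, Int.cast_negOnePow_natCast] at h
  rw [ascPochhammer_eval_div_factorial, h, ← mul_assoc, h1, one_mul]

/-- Kummer's transformation `₁F₁(m; 1; y) = e^y ₁F₁(1 - m; 1; -y)`. -/
theorem kummer_one_eq_exp_mul (m y : ℝ) :
    kummer m 1 y = Real.exp y * kummer (1 - m) 1 (-y) := by
  have hE : HasSum (fun n : ℕ => y ^ n / (n.factorial : ℝ)) (Real.exp y) := by
    rw [Real.exp_eq_exp_ℝ]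
    exact NormedSpace.expSeries_div_hasSum_exp y
  have hA := hasSum_kummer_one (1 - m) (-y)
  have hprod := tsum_mul_tsum_eq_tsum_sum_antidiagonal_of_summable_norm
    hA.summable.norm hE.summable.norm
  rw [hA.tsum_eq, hE.tsum_eq] at hprod
  rw [mul_comm, hprod, kummer_one_eq]
  refine tsum_congr fun N => ?_
  have hN : (N.factorial : ℝ) ≠ 0 := by exact_mod_cast N.factorial_ne_zero
  -- Chu–Vandermonde for `m - 1` and `N` expresses the coefficient of `yᴺ` in `₁F₁(m; 1; y)` as the
  -- one in the Cauchy product.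
  have hV := Ring.add_choose_eq N (Commute.all (m - 1) (N : ℝ))
  rw [ascPochhammer_eval_div_factorial, show m + N - 1 = m - 1 + (N : ℝ) by ring, hV,
    Finset.sum_mul]
  refine Finset.sum_congr rfl fun ij hij => ?_
  obtain ⟨i, j⟩ := ij
  have hs : i + j = N := Finset.HasAntidiagonal.mem_antidiagonal.1 hij
  have hi : (i.factorial : ℝ) ≠ 0 := by exact_mod_cast i.factorial_ne_zero
  have hj : (j.factorial : ℝ) ≠ 0 := by exact_mod_cast j.factorial_ne_zero
  have h1 : ((-1 : ℝ) ^ i) * (-1) ^ i = 1 := by rw [← mul_pow]; simp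
  have hch : (N.choose j : ℝ) * (i.factorial * j.factorial) = N.factorial := by
    have := Nat.add_choose_mul_factorial_mul_factorial i j
    rw [hs] at this
    have h2 : ((N.choose j * i.factorial * j.factorial : ℕ) : ℝ) = N.factorial := by rw [this]
    push_cast at h2
    linarith
  have hc0 : (N.choose j : ℝ) ≠ 0 := fun h => hN (by rw [← hch, h, zero_mul])
  simp only [ascPochhammer_one_sub_eval_div_factorial, Ring.choose_natCast]
  have hy : y ^ N = y ^ i * y ^ j := by rw [← hs, pow_add]
  rw [neg_pow y i, ← hch, hy]
  generalize (-1 : ℝ) ^ i = ε at h1 ⊢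
  field_simp
  linear_combination (-(Ring.choose (m - 1) i * y ^ i * y ^ j)) * h1

lemma Gamma_one_sub_add_nat {m : ℝ} (hm : ∀ n : ℤ, m ≠ n) (n : ℕ) :
    Real.Gamma (1 - m + n) = (ascPochhammer ℝ n).eval (1 - m) * Real.Gamma (1 - m) := by
  induction n with
  | zero => simp
  | succ n ih =>
    have h0 : 1 - m + n ≠ 0 := fun h => hm (1 + n) (by push_cast; linarith)
    rw [ascPochhammer_succ_eval, Nat.cast_succ, ← add_assoc, Real.Gamma_add_one h0, ih]
    ring

namespace MBContour

/-- The Mellin–Barnes representation of the confluent hypergeometric function. -/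
theorem SeparatesKummer.integral_eq {L : MBContour} {m y : ℝ} (hL : SeparatesKummer m L)
    (hm0 : 0 < m) (hm : ∀ n : ℤ, m ≠ n) (hy : 0 < y) :
    L.integral (fun t => kummerKernel m t * (y : ℂ) ^ (-t)) =
      2 * Real.pi * Complex.I *
        ((Real.Gamma (1 - m) * (Real.exp (-y) * kummer m 1 y) : ℝ) : ℂ) := by
  refine tendsto_nhds_unique (hL.tendsto_sum hm0 hm hy) ?_
  have h := ((hasSum_kummer_one (1 - m) (-y)).mul_left (Real.Gamma (1 - m))).tendsto_sum_nat
  have hk : kummer (1 - m) 1 (-y) = Real.exp (-y) * kummer m 1 y := by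
    rw [kummer_one_eq_exp_mul m y, ← mul_assoc, ← Real.exp_add]
    simp
  rw [hk] at h
  refine (((Complex.continuous_ofReal.tendsto _).comp h).const_mul _).congr fun N => ?_
  simp only [Function.comp_apply, Complex.ofReal_sum]
  congr 1
  refine Finset.sum_congr rfl fun n _ => ?_
  have hG : Complex.Gamma (1 - m + n) =
      (((ascPochhammer ℝ n).eval (1 - m) * Real.Gamma (1 - m) : ℝ) : ℂ) := by
    rw [← Gamma_one_sub_add_nat hm, ← Complex.Gamma_ofReal]
    push_cast
    rfl
  rw [hG, neg_pow]
  push_cast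
  ring

end MBContour

/-! ### Decoupling the double integral by Euler's integral -/

section Coupled

variable {p q a b : ℝ → ℂ} {σ₀ σ₁ : ℝ}

lemma integrableOn_exp_mul_rpow_add (h₀ : σ₀ < 1) (h₁ : σ₁ < 1) :
    IntegrableOn (fun r : ℝ => Real.exp (-r) * (r ^ (-σ₀) + r ^ (-σ₁))) (Ioi 0) := by
  have e : ∀ σ : ℝ, 1 - σ - 1 = -σ := fun σ => by ring
  have i0 := Real.GammaIntegral_convergent (s := 1 - σ₀) (by linarith)
  have i1 := Real.GammaIntegral_convergent (s := 1 - σ₁) (by linarith)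
  rw [e] at i0 i1
  simpa only [mul_add] using! i0.add i1

/-- The function obtained from `a(u) b(v) Γ(1 - p(u) - q(v))` by inserting Euler's integral. -/
def eulerIntegrand (p q a b : ℝ → ℂ) (z : (ℝ × ℝ) × ℝ) : ℂ :=
  a z.1.1 * b z.1.2 * ((Real.exp (-z.2) : ℂ) * (z.2 : ℂ) ^ (-(p z.1.1 + q z.1.2)))

/-- The modulus of the power of `r` is at most `r^(-σ₀) + r^(-σ₁)`; both terms are integrable
against `e⁻ʳ` since the exponents exceed `-1`, and the bound is a product in all three variables. -/
lemma integrable_eulerIntegrand (hp : Continuous p) (hq : Continuous q) (ha : Integrable a)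
    (hb : Integrable b) (h₀ : ∀ u v, σ₀ ≤ (p u + q v).re) (h₁ : ∀ u v, (p u + q v).re ≤ σ₁)
    (hσ : σ₁ < 1) : Integrable (eulerIntegrand p q a b)
      ((volume.prod volume).prod (volume.restrict (Ioi 0))) := by
  have hσ₀ : σ₀ < 1 := ((h₀ 0 0).trans (h₁ 0 0)).trans_lt hσ
  have hdom : Integrable (fun z : (ℝ × ℝ) × ℝ => (‖a z.1.1‖ * ‖b z.1.2‖) *
      (Real.exp (-z.2) * (z.2 ^ (-σ₀) + z.2 ^ (-σ₁))))
      ((volume.prod volume).prod (volume.restrict (Ioi 0))) :=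
    (ha.norm.mul_prod hb.norm).mul_prod (integrableOn_exp_mul_rpow_add hσ₀ hσ)
  refine hdom.mono' ?_ ?_
  · refine AEStronglyMeasurable.mul ?_ ?_
    · exact (ha.aestronglyMeasurable.comp_fst.mul hb.aestronglyMeasurable.comp_snd).comp_fst
    · refine Measurable.aestronglyMeasurable ?_
      have := hp.measurable
      have := hq.measurable
      fun_prop
  · have hpos : ∀ᵐ z ∂((volume.prod volume : Measure (ℝ × ℝ)).prod (volume.restrict (Ioi (0 : ℝ)))),
        z.2 ∈ Ioi (0 : ℝ) :=
      Measure.quasiMeasurePreserving_snd.ae (ae_restrict_mem measurableSet_Ioi)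
    filter_upwards [hpos] with z hz
    have hz0 : 0 < z.2 := hz
    rw [eulerIntegrand, norm_mul, norm_mul, norm_mul, norm_ofReal_cpow_neg hz0, Complex.norm_real,
      Real.norm_of_nonneg (Real.exp_pos _).le]
    gcongr
    rw [add_comm (z.2 ^ (-σ₀))]
    exact Real.rpow_le_rpow_add_rpow hz0 (neg_le_neg (h₁ _ _)) (neg_le_neg (h₀ _ _))

lemma integral_eulerIntegrand_right (u v : ℝ) (h : (p u + q v).re < 1) :
    ∫ r in Ioi (0 : ℝ), eulerIntegrand p q a b ((u, v), r) =
      Complex.Gamma (1 - (p u + q v)) * a u * b v := by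
  simp only [eulerIntegrand]
  rw [integral_const_mul, Complex.Gamma_eq_integral (by simpa using h), Complex.GammaIntegral]
  have e : (1 - (p u + q v) - 1 : ℂ) = -(p u + q v) := by ring
  rw [e]
  ring

lemma integral_eulerIntegrand_left {r : ℝ} (hr : 0 < r) :
    ∫ z : ℝ × ℝ, eulerIntegrand p q a b (z, r) = (Real.exp (-r) : ℂ) *
      ((∫ u, a u * (r : ℂ) ^ (-p u)) * ∫ v, b v * (r : ℂ) ^ (-q v)) := by
  have e : ∀ z : ℝ × ℝ, eulerIntegrand p q a b (z, r) = (Real.exp (-r) : ℂ) *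
      ((a z.1 * (r : ℂ) ^ (-p z.1)) * (b z.2 * (r : ℂ) ^ (-q z.2))) := fun z => by
    simp only [eulerIntegrand]
    rw [neg_add, Complex.cpow_add _ _ (Complex.ofReal_ne_zero.2 hr.ne')]
    ring
  simp_rw [e]
  rw [integral_const_mul, Measure.volume_eq_prod, integral_prod_mul
    (fun u => a u * (r : ℂ) ^ (-p u)) (fun v => b v * (r : ℂ) ^ (-q v))]

theorem integrable_Gamma_coupled (hp : Continuous p) (hq : Continuous q) (ha : Integrable a)
    (hb : Integrable b) (h₀ : ∀ u v, σ₀ ≤ (p u + q v).re) (h₁ : ∀ u v, (p u + q v).re ≤ σ₁)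
    (hσ : σ₁ < 1) : Integrable (fun z : ℝ × ℝ =>
      Complex.Gamma (1 - (p z.1 + q z.2)) * a z.1 * b z.2) (volume.prod volume) :=
  (integrable_eulerIntegrand hp hq ha hb h₀ h₁ hσ).integral_prod_left.congr
    (Eventually.of_forall fun z =>
      integral_eulerIntegrand_right z.1 z.2 ((h₁ _ _).trans_lt hσ))

/-- The other marginal in Fubini's theorem; convergence of the capacity integral comes from here. -/
theorem integrableOn_coupled (hp : Continuous p) (hq : Continuous q) (ha : Integrable a)
    (hb : Integrable b) (h₀ : ∀ u v, σ₀ ≤ (p u + q v).re) (h₁ : ∀ u v, (p u + q v).re ≤ σ₁)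
    (hσ : σ₁ < 1) : IntegrableOn (fun r : ℝ => (Real.exp (-r) : ℂ) *
      ((∫ u, a u * (r : ℂ) ^ (-p u)) * ∫ v, b v * (r : ℂ) ^ (-q v))) (Ioi 0) := by
  refine (integrable_eulerIntegrand hp hq ha hb h₀ h₁ hσ).integral_prod_right.congr ?_
  filter_upwards [ae_restrict_mem measurableSet_Ioi] with r hr
  exact integral_eulerIntegrand_left hr

/-- Euler's integral decouples the variables of a double integral with the factor
`Γ(1 - p(u) - q(v))`. -/
theorem integral_Gamma_coupled (hp : Continuous p) (hq : Continuous q) (ha : Integrable a)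
    (hb : Integrable b) (h₀ : ∀ u v, σ₀ ≤ (p u + q v).re) (h₁ : ∀ u v, (p u + q v).re ≤ σ₁)
    (hσ : σ₁ < 1) : ∫ u, ∫ v, Complex.Gamma (1 - (p u + q v)) * a u * b v =
      ∫ r in Ioi (0 : ℝ), (Real.exp (-r) : ℂ) *
        ((∫ u, a u * (r : ℂ) ^ (-p u)) * ∫ v, b v * (r : ℂ) ^ (-q v)) := by
  have hI := integrable_eulerIntegrand hp hq ha hb h₀ h₁ hσ
  have h1 := integral_prod _ (integrable_Gamma_coupled hp hq ha hb h₀ h₁ hσ)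
  rw [← h1]
  calc _ = ∫ z, (∫ r in Ioi (0 : ℝ), eulerIntegrand p q a b (z, r)) ∂(volume.prod volume) :=
        integral_congr_ae (Eventually.of_forall fun z =>
          (integral_eulerIntegrand_right z.1 z.2 ((h₁ _ _).trans_lt hσ)).symm)
    _ = ∫ r in Ioi (0 : ℝ), ∫ z, eulerIntegrand p q a b (z, r) ∂(volume.prod volume) :=
        integral_integral_swap (f := fun z r => eulerIntegrand p q a b (z, r)) hI
    _ = _ := setIntegral_congr_fun measurableSet_Ioi fun r hr => integral_eulerIntegrand_left hr

end Coupled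

/-! ### The double Mellin–Barnes integral as a single real integral -/

/-- The integrand of the capacity in the rescaled variable. -/
def scaledIntegrand (m X Y r : ℝ) : ℝ :=
  Real.exp (-r) * (Real.log (1 + X * r) * (Real.exp (-(Y * r)) * kummer m 1 (Y * r)))

namespace MBContour

variable {Ls Lt : MBContour} {m X Y : ℝ}

/-- The Mellin–Barnes integrand `F(s) X⁻ˢ ds`, pulled back to the parameter of the contour. -/
def pullback (L : MBContour) (F : ℂ → ℂ) (X : ℝ) (u : ℝ) : ℂ :=
  F (L.path u) * (X : ℂ) ^ (-L.path u) * deriv L.path u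

lemma integral_mul_cpow (L : MBContour) (F : ℂ → ℂ) {X r : ℝ} (hX : 0 < X) (hr : 0 < r) :
    ∫ u, L.pullback F X u * (r : ℂ) ^ (-L.path u) =
      L.integral (fun s => F s * ((X * r : ℝ) : ℂ) ^ (-s)) := by
  refine integral_congr_ae (Eventually.of_forall fun u => ?_)
  simp only [Complex.ofReal_mul, pullback]
  rw [Complex.mul_cpow_ofReal_nonneg hX.le hr.le]
  ring

/-- The logarithm formula was established for arguments other than `1`, which excludes the null set
`r = X⁻¹`. -/
lemma ae_coupled_eq (hs : Ls.SeparatesIntegers) (ht : SeparatesKummer m Lt) (hm0 : 0 < m)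
    (hm : ∀ n : ℤ, m ≠ n) (hX : 0 < X) (hY : 0 < Y) :
    ∀ᵐ r ∂(volume.restrict (Ioi (0 : ℝ))), (Real.exp (-r) : ℂ) *
      ((∫ u, Ls.pullback logKernel X u *
        (r : ℂ) ^ (-Ls.path u)) * ∫ v, Lt.pullback (kummerKernel m) Y v * (r : ℂ) ^ (-Lt.path v)) =
      (2 * Real.pi * Complex.I) ^ 2 * Real.Gamma (1 - m) * (scaledIntegrand m X Y r : ℂ) := by
  have hne : ∀ᵐ r ∂(volume.restrict (Ioi (0 : ℝ))), r ≠ X⁻¹ :=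
    ae_restrict_of_ae (by simp [ae_iff])
  filter_upwards [ae_restrict_mem measurableSet_Ioi, hne] with r (hr : 0 < r) hr1
  rw [integral_mul_cpow Ls logKernel hX hr, integral_mul_cpow Lt (kummerKernel m) hY hr,
    hs.integral_logKernel (mul_pos hX hr) (fun h => hr1 (eq_inv_of_mul_eq_one_right h)),
    ht.integral_eq hm0 hm (mul_pos hY hr), scaledIntegrand]
  push_cast
  ring

/-- The double Mellin–Barnes integral over contours that separate the poles. -/
theorem double_integral (hs : Ls.SeparatesIntegers) (ht : SeparatesKummer m Lt) (hm0 : 0 < m)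
    (hm : ∀ n : ℤ, m ≠ n) (hX : 0 < X) (hY : 0 < Y)
    (hst : ∀ u v, (Ls.path u + Lt.path v).re < 1) :
    Integrable (fun z : ℝ × ℝ => Complex.Gamma (1 - (Ls.path z.1 + Lt.path z.2)) *
      Ls.pullback logKernel X z.1 * Lt.pullback (kummerKernel m) Y z.2)
      (volume.prod volume) ∧
    IntegrableOn (scaledIntegrand m X Y) (Ioi 0) ∧
    ∫ u, ∫ v, Complex.Gamma (1 - (Ls.path u + Lt.path v)) *
      Ls.pullback logKernel X u * Lt.pullback (kummerKernel m) Y v =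
      (2 * Real.pi * Complex.I) ^ 2 *
        ((Real.Gamma (1 - m) * ∫ r in Ioi (0 : ℝ), scaledIntegrand m X Y r : ℝ) : ℂ) := by
  have ha : Integrable (Ls.pullback logKernel X) := Ls.integrable_mul_deriv
    (F := fun s => logKernel s * (X : ℂ) ^ (-s))
    (hs.continuous_logKernel hX) (verticalExpDecay_logKernel.mul_cpow hX)
  have hb : Integrable (Lt.pullback (kummerKernel m) Y) := Lt.integrable_mul_deriv
    (F := fun t => kummerKernel m t * (Y : ℂ) ^ (-t))
    (ht.continuous_kummerKernel hY) ((verticalExpDecay_kummerKernel m).mul_cpow hY)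
  obtain ⟨A, B, -, ⟨uB, hB⟩, hAB⟩ := Ls.exists_re_bounds
  obtain ⟨A', B', -, ⟨uB', hB'⟩, hAB'⟩ := Lt.exists_re_bounds
  have h₀ : ∀ u v, A + A' ≤ (Ls.path u + Lt.path v).re := fun u v => by
    rw [Complex.add_re]; linarith [(hAB u).1, (hAB' v).1]
  have h₁ : ∀ u v, (Ls.path u + Lt.path v).re ≤ B + B' := fun u v => by
    rw [Complex.add_re]; linarith [(hAB u).2, (hAB' v).2]
  have hσ : B + B' < 1 := by
    have := hst uB uB'
    rwa [Complex.add_re, hB, hB'] at this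
  have hae := ae_coupled_eq hs ht hm0 hm hX hY
  have hG : Real.Gamma (1 - m) ≠ 0 := Real.Gamma_ne_zero fun n h => hm (1 + n) (by
    push_cast; linarith)
  have hC : ((2 * Real.pi * Complex.I) ^ 2 * Real.Gamma (1 - m) : ℂ) ≠ 0 :=
    mul_ne_zero (pow_ne_zero _ Complex.two_pi_I_ne_zero) (Complex.ofReal_ne_zero.2 hG)
  refine ⟨integrable_Gamma_coupled Ls.continuous_path Lt.continuous_path ha hb h₀ h₁ hσ, ?_, ?_⟩
  -- The constant `(2πi)² Γ(1 - m)` is nonzero, so it can be cancelled from the integrable function.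
  · have := (integrableOn_coupled Ls.continuous_path Lt.continuous_path ha hb h₀ h₁ hσ).congr hae
    rw [integrable_const_mul_iff (IsUnit.mk0 _ hC)] at this
    exact this.re.congr (Eventually.of_forall fun r => by simp)
  · refine (integral_Gamma_coupled Ls.continuous_path Lt.continuous_path ha hb h₀ h₁ hσ).trans ?_
    rw [integral_congr_ae hae, integral_const_mul, integral_complex_ofReal]
    push_cast
    ring

end MBContour

/-! ### Construction of a contour separating the poles of the Kummer kernel -/

lemma contDiffOn_max_sub {a b c : ℝ} (h : c ∉ Ioo a b) :
    ContDiffOn ℝ 1 (fun u : ℝ => max (u - c) 0) (Icc a b) := by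
  rcases le_or_gt c a with hc | hc
  · refine (contDiff_id.sub contDiff_const : ContDiff ℝ 1 fun u : ℝ => u - c).contDiffOn.congr
      fun u hu => max_eq_left (by linarith [hu.1])
  · have hb : b ≤ c := not_lt.1 fun hb => h ⟨hc, hb⟩
    exact (contDiff_const : ContDiff ℝ 1 fun _ : ℝ => (0 : ℝ)).contDiffOn.congr
      fun u hu => max_eq_right (by linarith [hu.2])

namespace MBContour

/-- A function that is negative at the poles `0, -1, …` and positive at the poles
`1 - m, 2 - m, …` between `-m` and `1`, and vanishes at `-m` and `1`. -/
def separatingHeight (m x : ℝ) : ℝ :=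
  (Real.cos (2 * Real.pi * (x + m)) - Real.cos (2 * Real.pi * x)) * ((x + m) * (1 - x))

/-- The abscissa of the separating contour. -/
def separatingRe (m u : ℝ) : ℝ := -m + (1 + m) * (max (u - 0) 0 - max (u - 1) 0)

/-- The ordinate of the separating contour. -/
def separatingIm (m u : ℝ) : ℝ :=
  u - max (u - 0) 0 + separatingHeight m (separatingRe m u)
    + (2 * max (u - 1) 0 - max (u - 2) 0)

lemma separatingRe_of_nonpos {m u : ℝ} (h : u ≤ 0) : separatingRe m u = -m := by
  rw [separatingRe, max_eq_right (by linarith), max_eq_right (by linarith)]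
  ring

lemma separatingRe_of_one_le {m u : ℝ} (h : 1 ≤ u) : separatingRe m u = 1 := by
  rw [separatingRe, max_eq_left (by linarith), max_eq_left (by linarith)]
  ring

lemma separatingRe_of_mem {m u : ℝ} (h0 : 0 ≤ u) (h1 : u ≤ 1) :
    separatingRe m u = -m + (1 + m) * u := by
  rw [separatingRe, max_eq_left (by linarith), max_eq_right (by linarith)]
  ring

lemma separatingHeight_neg (m : ℝ) : separatingHeight m (-m) = 0 := by simp [separatingHeight]

lemma separatingHeight_one (m : ℝ) : separatingHeight m 1 = 0 := by simp [separatingHeight]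

lemma separatingIm_of_nonpos {m u : ℝ} (h : u ≤ 0) : separatingIm m u = u := by
  rw [separatingIm, separatingRe_of_nonpos h, separatingHeight_neg, max_eq_right (by linarith),
    max_eq_right (by linarith), max_eq_right (by linarith)]
  ring

lemma separatingIm_of_mem {m u : ℝ} (h0 : 0 ≤ u) (h1 : u ≤ 1) :
    separatingIm m u = separatingHeight m (separatingRe m u) := by
  rw [separatingIm, max_eq_left (by linarith), max_eq_right (by linarith),
    max_eq_right (by linarith)]
  ring

lemma separatingIm_of_two_le {m u : ℝ} (h : 2 ≤ u) : separatingIm m u = u := by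
  rw [separatingIm, separatingRe_of_one_le (by linarith), separatingHeight_one,
    max_eq_left (by linarith), max_eq_left (by linarith), max_eq_left (by linarith)]
  ring

lemma separatingIm_nonneg_of_one_le {m u : ℝ} (h : 1 ≤ u) : 0 ≤ separatingIm m u := by
  rw [separatingIm, separatingRe_of_one_le h, separatingHeight_one, max_eq_left (by linarith),
    max_eq_left (by linarith : (0 : ℝ) ≤ u - 1)]
  rcases max_cases (u - 2) 0 with ⟨h', -⟩ | ⟨h', -⟩ <;> rw [h'] <;> linarith

/-- A contour from `-m - i∞` to `1 + i∞` that separates `0, -1, …` from `1 - m, 2 - m, …`. -/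
def separating (m : ℝ) : MBContour where
  -- The path climbs `Re = -m` for `u ≤ 0`, follows the graph of the height over `[-m, 1]` for `0 ≤
  -- u ≤ 1`, and then climbs `Re = 1`, at double speed for `1 ≤ u ≤ 2` so that the ordinate is again
  -- `u` from there on.
  path u := (separatingRe m u : ℂ) + (separatingIm m u : ℂ) * Complex.I
  continuous_path := by
    unfold separatingIm separatingHeight separatingRe
    fun_prop
  piecewise_C1 := by
    refine ⟨{0, 1, 2}, fun a b _ hS => ?_⟩
    have hn : ∀ c ∈ ({0, 1, 2} : Finset ℝ), c ∉ Ioo a b := fun c hc h =>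
      Set.disjoint_left.1 hS h hc
    have c0 := contDiffOn_max_sub (hn 0 (by simp))
    have c1 := contDiffOn_max_sub (hn 1 (by simp))
    have c2 := contDiffOn_max_sub (hn 2 (by simp))
    have hx : ContDiffOn ℝ 1 (separatingRe m) (Icc a b) :=
      contDiffOn_const.add (contDiffOn_const.mul (c0.sub c1))
    have hh : ContDiff ℝ 1 (separatingHeight m) := by
      unfold separatingHeight
      fun_prop
    have hy : ContDiffOn ℝ 1 (separatingIm m) (Icc a b) :=
      ((contDiffOn_id.sub c0).add (hh.comp_contDiffOn hx)).add ((contDiffOn_const.mul c1).sub c2)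
    exact (Complex.ofRealCLM.contDiff.comp_contDiffOn hx).add
      ((Complex.ofRealCLM.contDiff.comp_contDiffOn hy).mul contDiffOn_const)
  lo := -m
  hi := 1
  vertical_ends := by
    refine ⟨2, two_pos, fun u hu => ?_, fun u hu => ?_⟩
    · rw [separatingRe_of_nonpos (by linarith), separatingIm_of_nonpos (by linarith)]
    · rw [separatingRe_of_one_le (by linarith), separatingIm_of_two_le hu]

variable {m : ℝ}

lemma separating_re (m u : ℝ) : ((separating m).path u).re = separatingRe m u := by
  simp [separating]

lemma separating_im (m u : ℝ) : ((separating m).path u).im = separatingIm m u := by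
  simp [separating]

lemma separatingRe_mem (hm : 0 < m) (u : ℝ) : separatingRe m u ∈ Icc (-m) 1 := by
  rcases le_total u 0 with h | h
  · rw [separatingRe_of_nonpos h]; constructor <;> linarith
  rcases le_total 1 u with h' | h'
  · rw [separatingRe_of_one_le h']; constructor <;> linarith
  · rw [separatingRe_of_mem h h']; constructor <;> nlinarith

lemma abs_separatingHeight_le {x : ℝ} (hx : x ∈ Icc (-m) 1) :
    |separatingHeight m x| ≤ 2 * (1 + m) ^ 2 := by
  obtain ⟨h1, h2⟩ := hx
  rw [separatingHeight, abs_mul]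
  have hc : |Real.cos (2 * Real.pi * (x + m)) - Real.cos (2 * Real.pi * x)| ≤ 2 := by
    rw [abs_le]
    constructor <;> linarith [Real.cos_le_one (2 * Real.pi * (x + m)),
      Real.neg_one_le_cos (2 * Real.pi * (x + m)), Real.cos_le_one (2 * Real.pi * x),
      Real.neg_one_le_cos (2 * Real.pi * x)]
  have hp : |(x + m) * (1 - x)| ≤ (1 + m) ^ 2 := by
    rw [abs_of_nonneg (mul_nonneg (by linarith) (by linarith)), sq]
    exact mul_le_mul (by linarith) (by linarith) (by linarith) (by linarith)
  gcongr

lemma cos_two_pi_mul_lt_one (hm : ∀ n : ℤ, m ≠ n) : Real.cos (2 * Real.pi * m) < 1 := by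
  refine lt_of_le_of_ne (Real.cos_le_one _) fun h => ?_
  obtain ⟨n, hn⟩ := (Real.cos_eq_one_iff _).1 h
  exact hm n (mul_left_cancel₀ (by positivity : 2 * Real.pi ≠ 0) (by linarith))

/-- At `-n` the cosine difference is `cos(2πm) - 1 < 0`, and at `1 - m + n` it is the opposite; the
quadratic factor is positive inside the interval. -/
lemma separatingHeight_neg_nat_neg (hm : ∀ n : ℤ, m ≠ n) {n : ℕ} (h : -m < -(n : ℝ)) :
    separatingHeight m (-n) < 0 := by
  have e1 : Real.cos (2 * Real.pi * (-n + m)) = Real.cos (2 * Real.pi * m) := by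
    rw [← Real.cos_sub_nat_mul_two_pi (2 * Real.pi * m) n]; congr 1; ring
  have e2 : Real.cos (2 * Real.pi * (-n)) = 1 := by
    rw [mul_neg, Real.cos_neg, mul_comm]; exact Real.cos_nat_mul_two_pi n
  rw [separatingHeight, e1, e2]
  have hn : (0 : ℝ) ≤ n := n.cast_nonneg
  exact mul_neg_of_neg_of_pos (by linarith [cos_two_pi_mul_lt_one hm])
    (mul_pos (by linarith) (by linarith))

lemma separatingHeight_right_pos (hm : ∀ n : ℤ, m ≠ n) {n : ℕ} (h : 1 - m + n < 1) :
    0 < separatingHeight m (1 - m + n) := by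
  have e1 : Real.cos (2 * Real.pi * (1 - m + n + m)) = 1 := by
    rw [show 2 * Real.pi * (1 - m + n + m) = ((1 + n : ℕ) : ℝ) * (2 * Real.pi) by push_cast; ring]
    exact Real.cos_nat_mul_two_pi _
  have e2 : Real.cos (2 * Real.pi * (1 - m + n)) = Real.cos (2 * Real.pi * m) := by
    rw [← Real.cos_nat_mul_two_pi_sub (2 * Real.pi * m) (1 + n)]; congr 1; push_cast; ring
  rw [separatingHeight, e1, e2]
  have hn : (0 : ℝ) ≤ n := n.cast_nonneg
  exact mul_pos (by linarith [cos_two_pi_mul_lt_one hm]) (mul_pos (by linarith) (by linarith))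

lemma not_mem_range_separating {z : ℂ}
    (h : ∀ u, separatingRe m u = z.re → separatingIm m u = z.im → False) :
    z ∈ (range (separating m).path)ᶜ := by
  rintro ⟨u, rfl⟩
  exact h u (separating_re m u).symm (separating_im m u).symm

lemma joinedIn_of_re_eq {U : Set ℂ} {z w : ℂ} (hre : z.re = w.re)
    (h : ∀ s : ℂ, s.re = z.re → min z.im w.im ≤ s.im → s.im ≤ max z.im w.im → s ∈ U) :
    JoinedIn U z w := by
  refine JoinedIn.of_segment_subset fun s hs => ?_
  obtain ⟨a, b, ha, hb, hab, rfl⟩ := hs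
  have e : (a • z + b • w).im = a * z.im + b * w.im := by simp
  refine h _ ?_ ?_ ?_
  · simp [← hre, ← add_mul, hab]
  · rw [e]
    have h1 := mul_le_mul_of_nonneg_left (min_le_left z.im w.im) ha
    have h2 := mul_le_mul_of_nonneg_left (min_le_right z.im w.im) hb
    have h3 : a * min z.im w.im + b * min z.im w.im = min z.im w.im := by
      rw [← add_mul, hab, one_mul]
    linarith
  · rw [e]
    have h1 := mul_le_mul_of_nonneg_left (le_max_left z.im w.im) ha
    have h2 := mul_le_mul_of_nonneg_left (le_max_right z.im w.im) hb
    have h3 : a * max z.im w.im + b * max z.im w.im = max z.im w.im := by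
      rw [← add_mul, hab, one_mul]
    linarith

lemma joinedIn_of_im_eq {U : Set ℂ} {z w : ℂ} (him : z.im = w.im)
    (h : ∀ s : ℂ, s.im = z.im → min z.re w.re ≤ s.re → s.re ≤ max z.re w.re → s ∈ U) :
    JoinedIn U z w := by
  refine JoinedIn.of_segment_subset fun s hs => ?_
  obtain ⟨a, b, ha, hb, hab, rfl⟩ := hs
  have e : (a • z + b • w).re = a * z.re + b * w.re := by simp
  refine h _ ?_ ?_ ?_
  · simp [← him, ← add_mul, hab]
  · rw [e]
    have h1 := mul_le_mul_of_nonneg_left (min_le_left z.re w.re) ha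
    have h2 := mul_le_mul_of_nonneg_left (min_le_right z.re w.re) hb
    have h3 : a * min z.re w.re + b * min z.re w.re = min z.re w.re := by
      rw [← add_mul, hab, one_mul]
    linarith
  · rw [e]
    have h1 := mul_le_mul_of_nonneg_left (le_max_left z.re w.re) ha
    have h2 := mul_le_mul_of_nonneg_left (le_max_right z.re w.re) hb
    have h3 : a * max z.re w.re + b * max z.re w.re = max z.re w.re := by
      rw [← add_mul, hab, one_mul]
    linarith

lemma separating_lt_of_lt_one (hm : 0 < m) {u : ℝ} (h : separatingRe m u < 1) :
    separatingIm m u < 2 * (1 + m) ^ 2 + 1 := by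
  have hu : u < 1 := not_le.1 fun h' => by rw [separatingRe_of_one_le h'] at h; exact lt_irrefl _ h
  rcases le_total u 0 with h0 | h0
  · rw [separatingIm_of_nonpos h0]; linarith [sq_nonneg (1 + m)]
  · rw [separatingIm_of_mem h0 hu.le]
    linarith [(abs_le.1 (abs_separatingHeight_le (separatingRe_mem hm u))).2]

lemma lt_separating_of_lt (hm : 0 < m) {u : ℝ} (h : -m < separatingRe m u) :
    -(2 * (1 + m) ^ 2 + 1) < separatingIm m u := by
  have hu : 0 < u := not_le.1 fun h' => by rw [separatingRe_of_nonpos h'] at h; exact lt_irrefl _ h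
  rcases le_total 1 u with h1 | h1
  · have := separatingIm_nonneg_of_one_le (m := m) h1
    nlinarith
  · rw [separatingIm_of_mem hu.le h1]
    linarith [(abs_le.1 (abs_separatingHeight_le (separatingRe_mem hm u))).1]

lemma separatingIm_eq_height {u x : ℝ} (hx : separatingRe m u = x) (h0 : -m < x) (h1 : x < 1) :
    separatingIm m u = separatingHeight m x := by
  subst hx
  refine separatingIm_of_mem (not_lt.1 fun h => ?_) (not_lt.1 fun h => ?_)
  · rw [separatingRe_of_nonpos h.le] at h0; exact lt_irrefl _ h0
  · rw [separatingRe_of_one_le h.le] at h1; exact lt_irrefl _ h1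

/-- A pole `-n > -m` lies above the wave: going up to height `H`, above everything on the contour
left of `Re = 1`, and then left, avoids the contour. A pole `1 - m + n < 1` lies below the wave and
escapes by going down to `-H` and then right. All other poles are beyond the range of abscissas. -/
theorem separatesKummer_separating (hm0 : 0 < m) (hm : ∀ n : ℤ, m ≠ n) :
    SeparatesKummer m (separating m) := by
  set H := 2 * (1 + m) ^ 2 + 1 with hH
  have hHpos : 0 < H := by positivity
  refine ⟨fun n => ?_, fun n => ?_⟩
  · have hn : (0 : ℝ) ≤ n := n.cast_nonneg
    rcases lt_or_gt_of_ne (show (-m : ℝ) ≠ -n from fun h => hm n (by push_cast; linarith))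
      with h | h
    swap
    · refine mem_leftSide_of_re_lt fun u => ?_
      rw [separating_re]
      have := (separatingRe_mem hm0 u).1
      simp
      linarith
    refine ⟨⟨-m - 1, H⟩, fun u => ?_, ?_⟩
    · rw [separating_re]
      have := (separatingRe_mem hm0 u).1
      simp
      linarith
    · refine JoinedIn.trans (y := ⟨-n, H⟩)
        (joinedIn_of_re_eq (by simp) fun s hs1 hs2 hs3 => ?_)
        (joinedIn_of_im_eq rfl fun s hs1 hs2 hs3 => ?_)
      · refine not_mem_range_separating fun u hu1 hu2 => ?_
        simp only [Complex.neg_re, Complex.natCast_re, Complex.neg_im, Complex.natCast_im,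
          neg_zero, min_eq_left hHpos.le] at hs1 hs2
        have := separatingIm_eq_height (hu1.trans hs1) h (by linarith)
        have := separatingHeight_neg_nat_neg hm h
        linarith
      · refine not_mem_range_separating fun u hu1 hu2 => ?_
        simp only at hs1 hs3
        have h3 : s.re ≤ 0 := hs3.trans (max_le (by linarith) (by linarith))
        have := separating_lt_of_lt_one hm0 (u := u) (by linarith)
        linarith
  · have hn : (0 : ℝ) ≤ n := n.cast_nonneg
    have ere : (1 - m + n : ℂ).re = 1 - m + n := by simp
    have eim : (1 - m + n : ℂ).im = 0 := by simp
    rcases lt_or_gt_of_ne (show (1 - m + n : ℝ) ≠ 1 from fun h => hm n (by push_cast; linarith))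
      with h | h
    swap
    · refine mem_rightSide_of_lt_re fun u => ?_
      rw [separating_re, ere]
      linarith [(separatingRe_mem hm0 u).2]
    refine ⟨⟨2, -H⟩, fun u => ?_, ?_⟩
    · rw [separating_re]
      have := (separatingRe_mem hm0 u).2
      simp only
      linarith
    · refine JoinedIn.trans (y := ⟨1 - m + n, -H⟩)
        (joinedIn_of_re_eq ere fun s hs1 hs2 hs3 => ?_)
        (joinedIn_of_im_eq rfl fun s hs1 hs2 hs3 => ?_)
      · refine not_mem_range_separating fun u hu1 hu2 => ?_
        rw [ere] at hs1
        rw [eim] at hs3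
        simp only [max_eq_left (neg_nonpos.2 hHpos.le)] at hs3
        have := separatingIm_eq_height (hu1.trans hs1) (by linarith) h
        have := separatingHeight_right_pos hm h
        linarith
      · refine not_mem_range_separating fun u hu1 hu2 => ?_
        simp only at hs1 hs2
        have h3 : 1 - m + n ≤ s.re := (le_min le_rfl (by linarith)).trans hs2
        have := lt_separating_of_lt hm0 (u := u) (by linarith)
        linarith

end MBContour

/-! ### Identification of the integrands and the main theorem -/

/-- Reflection at `-s` evaluates `Γ(1 + s) Γ(-s)`, and `Γ(1 - s) = -s Γ(-s)` disposes of the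
remaining quotient. -/
lemma gamma_quotient_eq_logKernel {s : ℂ} (hs : ∀ n : ℤ, s ≠ n) :
    Complex.Gamma (1 + s) * (Complex.Gamma (-s) * Complex.Gamma (-s)) / Complex.Gamma (1 - s) =
      logKernel s := by
  have h0 : s ≠ 0 := by simpa using hs 0
  have hG : Complex.Gamma (-s) ≠ 0 := Complex.Gamma_ne_zero fun n h => hs n (by
    simpa using h)
  have hsin := sin_pi_mul_ne_zero (x := s) fun ⟨n, hn⟩ => hs n hn.symm
  have h1 : Complex.Gamma (1 - s) = -s * Complex.Gamma (-s) := by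
    rw [← Complex.Gamma_add_one _ (neg_ne_zero.2 h0)]; congr 1; ring
  have href := Complex.Gamma_mul_Gamma_one_sub (-s)
  rw [sub_neg_eq_add, mul_neg, Complex.sin_neg] at href
  rw [logKernel, h1, ← mul_assoc, mul_comm (Complex.Gamma (1 + s)), href]
  generalize Complex.sin (Real.pi * s) = S at hsin ⊢
  field_simp

lemma gamma_quotient_eq_kummerKernel (m : ℝ) (t : ℂ) :
    Complex.Gamma t * Complex.Gamma (1 - m - t) / Complex.Gamma (1 - t) = kummerKernel m t :=
  div_eq_mul_inv _ _

/-- The integrand of the capacity at `γ = X r`. -/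
lemma scaledIntegrand_eq {m k gbar x : ℝ} (hm : 0 < m) (hk : 0 < k) (hgbar : 0 < gbar)
    (hx : 0 < x) (r : ℝ) :
    condCapacityIntegrand m k gbar x (gbar * (k + m * x) / (m * (k + 1)) * r) =
      (gbar * (k + m * x) / (m * (k + 1)))⁻¹ * ((m * x / (k + m * x)) ^ (m - 1) / Real.log 2) *
        scaledIntegrand m (gbar * (k + m * x) / (m * (k + 1))) (k / (m * x)) r := by
  have hB : 0 < m * x / (k + m * x) := by positivity
  have hlog : Real.log 2 ≠ 0 := (Real.log_pos one_lt_two).ne'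
  have e1 : (1 + condK k x) / condAvgSNR k gbar x * (gbar * (k + m * x) / (m * (k + 1)) * r) =
      r + k / (m * x) * r := by
    rw [condK, condAvgSNR]
    field_simp
    ring
  have e2 : condK k x * (1 + condK k x) / (condK k x + m) *
      (gbar * (k + m * x) / (m * (k + 1)) * r / condAvgSNR k gbar x) = k / (m * x) * r := by
    rw [condK, condAvgSNR]
    field_simp
    ring
  have e3 : m ^ m * (1 + condK k x) / ((m + condK k x) ^ m * condAvgSNR k gbar x) =
      (gbar * (k + m * x) / (m * (k + 1)))⁻¹ * (m * x / (k + m * x)) ^ (m - 1) := by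
    have h1 : (m * x / (k + m * x)) ^ m = m ^ m / (m + condK k x) ^ m := by
      rw [← Real.div_rpow hm.le (by rw [condK]; positivity)]
      congr 1
      rw [condK]
      field_simp
      ring
    rw [Real.rpow_sub_one hB.ne', h1]
    have h2 : (m + condK k x) ^ m ≠ 0 := (Real.rpow_pos_of_pos (by rw [condK]; positivity) _).ne'
    -- With the real powers made opaque, the rest is an identity of rational functions.
    generalize (m + condK k x) ^ m = P at h2 ⊢
    generalize m ^ m = Q
    rw [condK, condAvgSNR]
    field_simp
    ring
  rw [condCapacityIntegrand, condPDF, e1, e2, e3, scaledIntegrand, Real.logb, neg_add,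
    Real.exp_add]
  field_simp

end

theorem lemma1 (m k gbar x : ℝ) (hm : 0 < m) (hm_nonint : ∀ n : ℤ, m ≠ (n : ℝ))
    (hk : 0 < k) (hgbar : 0 < gbar) (hx : 0 < x) :
    IntegrableOn (condCapacityIntegrand m k gbar x) (Ioi 0) ∧
    ∃ G : ℂ,
      HasEGBMG
        { m := 0, n := 1, a := [0], b := [], hm := by simp, hn := by simp }
        { m := 1, n := 2, a := [1, 1], b := [1, 0], hm := by simp, hn := by simp }
        { m := 1, n := 1, a := [(m : ℂ)], b := [0, 0], hm := by simp, hn := by simp }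
        (gbar * (k + m * x) / (m * (k + 1))) (k / (m * x)) G ∧
      (condCapacityORA m k gbar x : ℂ) =
        (((m * x / (k + m * x)) ^ (m - 1) * (1 / (Real.Gamma (1 - m) * Real.log 2)) : ℝ) : ℂ)
          * G := by
  set X := gbar * (k + m * x) / (m * (k + 1)) with hXdef
  set Y := k / (m * x) with hYdef
  have hX : 0 < X := by positivity
  have hY : 0 < Y := by positivity
  have hG : Real.Gamma (1 - m) ≠ 0 := Real.Gamma_ne_zero fun n h => hm_nonint (1 + n) (by
    push_cast; linarith)
  have hS : MBContour.SeparatesKummer m (MBContour.separating m) :=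
    MBContour.separatesKummer_separating hm hm_nonint
  have hst : ∀ u v,
      ((MBContour.verticalLine (-1 / 2)).path u + (MBContour.separating m).path v).re < 1 :=
    fun u v => by
      rw [Complex.add_re, MBContour.verticalLine_path_re, MBContour.separating_re]
      linarith [(MBContour.separatingRe_mem hm v).2]
  -- The explicit pair has `Re s = -1/2` and `Re t ≤ 1`, hence `Re(s + t) ≤ 1/2`. Besides witnessing
  -- existence, it yields convergence of the capacity integral.
  have hscaled := (MBContour.double_integral MBContour.separatesIntegers_verticalLine hS hm
    hm_nonint hX hY hst).2.1
  have hcap : ∀ r, condCapacityIntegrand m k gbar x (X * r) =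
      X⁻¹ * ((m * x / (k + m * x)) ^ (m - 1) / Real.log 2) * scaledIntegrand m X Y r :=
    scaledIntegrand_eq hm hk hgbar hx
  refine ⟨?_, ((Real.Gamma (1 - m) * ∫ r in Ioi (0 : ℝ), scaledIntegrand m X Y r : ℝ) : ℂ),
    ⟨⟨MBContour.verticalLine (-1 / 2), MBContour.separating m, ?_⟩, ?_⟩, ?_⟩
  · rw [← mul_zero X, ← integrableOn_Ioi_comp_mul_left_iff _ _ hX]
    simp_rw [hcap]
    exact hscaled.const_mul _
  · refine ⟨⟨?_, ?_⟩, ⟨?_, ?_⟩, ?_, ?_⟩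
    -- The lower parameter `1` produces the poles `-1 - n` on the left; both upper parameters `1`
    -- produce the same poles `n` on the right.
    · simpa using MBContour.separatesIntegers_verticalLine.1
    · simpa using MBContour.separatesIntegers_verticalLine.2
    · simpa using hS.1
    · simpa using hS.2
    · simp
    · intro a ha u v
      obtain rfl : a = 0 := by simpa using ha
      have := hst u v
      rw [Complex.sub_re, sub_zero, Complex.one_re]
      linarith
  · intro Ls Lt hadm
    have hs : Ls.SeparatesIntegers :=
      ⟨by simpa using hadm.sep_s.1, by simpa using hadm.sep_s.2⟩
    have ht : MBContour.SeparatesKummer m Lt :=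
      ⟨by simpa using hadm.sep_t.1, by simpa using hadm.sep_t.2⟩
    have hst : ∀ u v, (Ls.path u + Lt.path v).re < 1 := fun u v => by
      have := hadm.coupled_a 0 (by simp) u v
      rw [Complex.sub_re, sub_zero, Complex.one_re] at this
      linarith
    obtain ⟨h1, -, h3⟩ := MBContour.double_integral hs ht hm hm_nonint hX hY hst
    have e : ∀ u v, egbmgIntegrand
        { m := 0, n := 1, a := [0], b := [], hm := by simp, hn := by simp }
        { m := 1, n := 2, a := [1, 1], b := [1, 0], hm := by simp, hn := by simp }
        { m := 1, n := 1, a := [(m : ℂ)], b := [0, 0], hm := by simp, hn := by simp }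
        X Y Ls Lt u v = Complex.Gamma (1 - (Ls.path u + Lt.path v)) *
          Ls.pullback logKernel X u * Lt.pullback (kummerKernel m) Y v := fun u v => by
      rw [MBContour.pullback, MBContour.pullback, ← gamma_quotient_eq_logKernel (hs.ne_intCast u),
        ← gamma_quotient_eq_kummerKernel]
      simp [egbmgIntegrand, MeijerParams.Psi]
      ring
    simp_rw [e]
    refine ⟨h1, ?_⟩
    rw [h3, ← mul_assoc, one_div, inv_mul_cancel₀ (pow_ne_zero _ Complex.two_pi_I_ne_zero), one_mul]
  -- The Jacobian of `γ = Xr` cancels the `X⁻¹` of the density, and the `Γ(1 - m)` in the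
  -- denominator cancels the one in `G`.
  · have hint := integral_comp_mul_left_Ioi (condCapacityIntegrand m k gbar x) 0 hX
    simp_rw [hcap] at hint
    rw [integral_const_mul, mul_zero, smul_eq_mul] at hint
    have hC : condCapacityORA m k gbar x = (m * x / (k + m * x)) ^ (m - 1) / Real.log 2 *
        ∫ r in Ioi (0 : ℝ), scaledIntegrand m X Y r := by
      rw [condCapacityORA]
      apply mul_left_cancel₀ (inv_ne_zero hX.ne')
      rw [← hint]
      ring
    have hlog : Real.log 2 ≠ 0 := (Real.log_pos one_lt_two).ne'
    rw [hC, ← Complex.ofReal_mul]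
    congr 1
    field_simp
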